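/- Let $(g_k)_{k\in\mathbb N}$ be rational maps of degree two on the Riemann sphere $\widehat{\mathbb C}=\mathbb C\cup\{\infty\}$, and let $a_k,b_k,c_k\in\widehat{\mathbb C}$ be the fixed points of $g_k$, listed with multiplicity, with eigenvalues (multipliers) $\alpha_k,\beta_k,\gamma_k\in\mathbb C$ respectively. Suppose that $\alpha_k$ and $\beta_k$ converge in $\widehat{\mathbb C}$ and that $\gamma_k\to\infty$ as $k\to\infty$. Assume that there is an integer $n>1$ such that every $g_k$ has a cycle $\langle z_k\rangle\subset\widehat{\mathbb C}$ of exact period $n$, and that the eigenvalues of these cycles (that is, the multipliers of $g_k^{\,n}$ at $z_k$) are bounded uniformly in $k$. Put $\epsilon_k=1-\alpha_k\beta_k$. Then there are an integer $q$ with $1\le q\le n$ and a $q$-th root of unity $\omega\neq 1$ such that, as $k\to\infty$, $$\alpha_k=\omega+O\big(\sqrt{|\epsilon_k|}\big),\qquad \beta_k=\overline{\omega}+O\big(\sqrt{|\epsilon_k|}\big),\qquad \epsilon_k=O\Big(\frac{1}{\gamma_k}\Big).$$ -/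

import Mathlib

open Filter Topology Asymptotics

namespace RationalDynamics

/-- The Riemann sphere `ℂ ∪ {∞}`. -/
abbrev Sphere : Type := OnePoint ℂ

namespace Sphere

/-- The point `[x : y]` of the sphere, that is `x / y`, read as `∞` when `y = 0`. -/
noncomputable def ratio (x y : ℂ) : Sphere :=
  if y = 0 then OnePoint.infty else ((x / y : ℂ) : OnePoint ℂ)

/-- The inversion `z ↦ 1 / z`, exchanging `0` and `∞`. -/
noncomputable def inversion : Sphere → Sphere
  | OnePoint.infty => ((0 : ℂ) : OnePoint ℂ)
  | OnePoint.some z => ratio 1 z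

/-- The affine coordinate of a point of the sphere (with the value `0` at `∞`, which
plays no role in what follows). -/
def coord : Sphere → ℂ
  | OnePoint.infty => 0
  | OnePoint.some z => z

end Sphere

/-- A self-map `h` of the sphere read in the standard local coordinate at `ζ`:
the coordinate `z` when `ζ` is finite, the coordinate `w = 1 / z` when `ζ = ∞`. -/
noncomputable def localForm (h : Sphere → Sphere) : Sphere → ℂ → ℂ
  | OnePoint.infty => fun w =>
      Sphere.coord (Sphere.inversion (h (Sphere.inversion (w : OnePoint ℂ))))
  | OnePoint.some _ => fun w => Sphere.coord (h (w : OnePoint ℂ))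

/-- The value at `ζ` of the standard local coordinate at `ζ`. -/
def localCoord : Sphere → ℂ
  | OnePoint.infty => 0
  | OnePoint.some z => z

/-- The eigenvalue (multiplier) of a holomorphic self-map `h` of the sphere at a fixed point `ζ`:
the derivative of `h` at `ζ` in the local coordinate. -/
noncomputable def eigenvalue (h : Sphere → Sphere) (ζ : Sphere) : ℂ :=
  deriv (localForm h ζ) (localCoord ζ)

open Classical in
/-- The multiplicity of `ζ` as a fixed point of a holomorphic self-map `h` of the sphere:
the order of vanishing of `z - h z` at `ζ` in the local coordinate (and `0` if `ζ` is not fixed). -/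
noncomputable def fixedMultiplicity (h : Sphere → Sphere) (ζ : Sphere) : ℕ∞ :=
  if h ζ = ζ then analyticOrderAt (fun w => w - localForm h ζ w) (localCoord ζ) else 0

open Classical in
/-- `s` is the unordered tuple of the fixed points of `h`, listed with multiplicity. -/
def IsFixedPointList (h : Sphere → Sphere) (s : Multiset Sphere) : Prop :=
  ∀ ζ : Sphere, fixedMultiplicity h ζ = (s.count ζ : ℕ∞)

/-- A quadratic rational map
`z ↦ (A₂ z² + A₁ z + A₀) / (B₂ z² + B₁ z + B₀)`, of degree exactly two: the resultant of the
numerator and the denominator does not vanish. -/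
structure QuadraticRationalMap where
  (A₂ A₁ A₀ B₂ B₁ B₀ : ℂ)
  resultant_ne_zero :
    Matrix.det !![A₂, A₁, A₀, 0; 0, A₂, A₁, A₀; B₂, B₁, B₀, 0; 0, B₂, B₁, B₀] ≠ 0

/-- The action of a quadratic rational map on the sphere. -/
noncomputable def QuadraticRationalMap.toFun (g : QuadraticRationalMap) : Sphere → Sphere
  | OnePoint.infty => Sphere.ratio g.A₂ g.B₂
  | OnePoint.some z =>
      Sphere.ratio (g.A₂ * z ^ 2 + g.A₁ * z + g.A₀) (g.B₂ * z ^ 2 + g.B₁ * z + g.B₀)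

noncomputable instance : CoeFun QuadraticRationalMap (fun _ => Sphere → Sphere) :=
  ⟨QuadraticRationalMap.toFun⟩

end RationalDynamics

/-!
# Quadratic rational maps with a fixed point eigenvalue tending to infinity

If the fixed points with eigenvalues `α` and `β` are distinct, a Möbius change of coordinate moves
them to `0` and `∞`, and the map becomes `G t = t (t + α) / (β t + 1)`
(`exists_isNormalForm`). Put `ε = 1 - α β`, which is not `0`. The eigenvalue at the third fixed
point satisfies `γ ε = 2 - α - β` (`IsNormalForm.eigenvalue_mul_eps`). A cycle of period `n > 1`
avoids `0` and `∞`, and its eigenvalue is the product of the derivatives `G'(t i)` along it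
(`IsNormalForm.exists_cycle`).

The core is `exists_norm_pow_sub_one_le`, for `α` and `β` bounded and bounded away from `0`. Write
`t G'(t) / G(t) = 1 + u`. The factors `t (i + 1) / t i` cancel around a cycle, so the eigenvalue is
`∏ (1 + u i)`. Where `u` is bounded, `G` is multiplication by `α + O(√|ε|)`; where `u` is bounded
below, `t` is within `O(√|ε|)` of `-α`. If the product is bounded, then either all the `u i` are
bounded, or some factor `1 + u j` is small in order to make up for a large one, and `u j` is then
near `-1`. Following the cycle from `j` to the next index with a large `u` leads back to within
`O(√|ε|)` of the starting point (`exists_bounded_stretch`). In both cases some `q ≤ n` has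
`α ^ q = 1 + O(√|ε|)`.

The other configurations are excluded as follows.
* If `α → ∞`, the formula for `γ` forces `β → 0`. The cycle then stays near `0` and `-α`, where `G`
  is strongly expanding, so its eigenvalue is unbounded (`exists_lt_norm_prod_normalDeriv`).
* If the first two fixed points coincide, move that double point to `∞` and the third one to `0`.
  In a suitable coordinate the map is `T ↦ T + D (1 - 1 / T)` with `D = γ - 1`, a translation by
  nearly `D` except near `0`. As in the core, some stretch of the cycle comes back to within
  `O(√|D|)` of its start while its length `q ≥ 1` translates it by `q D + O(√|D|)`, which bounds `γ`
  (`exists_norm_sub_one_le_of_double`).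
* If `α → 1`, then `α - 1 = O(√|ε|)` contradicts `γ → ∞`, by the formula for `γ`
  (`norm_le_of_norm_sub_one_le`).

So `α` and `β` have finite limits `ω` and `1 / ω`, where `ω ≠ 1` is a root of unity of order at
most `n`, and `ε = (2 - α - β) / γ = O(1 / γ)`.
-/

namespace RationalDynamics

/-! ### Homogeneous coordinates on the sphere -/

namespace Sphere

lemma ratio_of_ne {x y : ℂ} (hy : y ≠ 0) : ratio x y = ((x / y : ℂ) : OnePoint ℂ) := if_neg hy

lemma ratio_zero_right (x : ℂ) : ratio x 0 = OnePoint.infty := if_pos rfl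

lemma ratio_mul_left {k : ℂ} (hk : k ≠ 0) (x y : ℂ) : ratio (k * x) (k * y) = ratio x y := by
  by_cases hy : y = 0
  · simp [hy, ratio_zero_right]
  · rw [ratio_of_ne hy, ratio_of_ne (mul_ne_zero hk hy), mul_div_mul_left _ _ hk]

lemma ratio_eq_ratio_iff {x y x' y' : ℂ} (h : x ≠ 0 ∨ y ≠ 0) (h' : x' ≠ 0 ∨ y' ≠ 0) :
    ratio x y = ratio x' y' ↔ x * y' = x' * y := by
  by_cases hy : y = 0 <;> by_cases hy' : y' = 0
  · simp [hy, hy', ratio_zero_right]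
  · subst hy
    have hx : x ≠ 0 := by simpa using h
    simp [ratio_zero_right, ratio_of_ne hy', hx, hy']
  · subst hy'
    have hx : x' ≠ 0 := by simpa using h'
    simp [ratio_zero_right, ratio_of_ne hy, hx, hy]
  · rw [ratio_of_ne hy, ratio_of_ne hy', OnePoint.coe_eq_coe, div_eq_div_iff hy hy']

lemma exists_ratio_eq (ζ : Sphere) : ∃ x y : ℂ, (x ≠ 0 ∨ y ≠ 0) ∧ ratio x y = ζ := by
  induction ζ using OnePoint.rec with
  | infty => exact ⟨1, 0, by simp, ratio_zero_right 1⟩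
  | coe z => exact ⟨z, 1, by simp, by simp [ratio_of_ne]⟩

/-- This holds also at `∞`, where `coord` and division by `0` both take the value `0`. -/
lemma coord_ratio (x y : ℂ) : coord (ratio x y) = x / y := by
  by_cases hy : y = 0
  · subst hy; rw [ratio_zero_right, div_zero]; rfl
  · rw [ratio_of_ne hy]; rfl

lemma coord_inversion_ratio (x y : ℂ) : coord (inversion (ratio x y)) = y / x := by
  by_cases hy : y = 0
  · subst hy; rw [ratio_zero_right, zero_div]; rfl
  · rw [ratio_of_ne hy]
    change coord (ratio 1 (x / y)) = _
    rw [coord_ratio, one_div_div]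

lemma inversion_coe (w : ℂ) : inversion (w : OnePoint ℂ) = ratio 1 w := rfl

end Sphere

open Sphere

/-! ### Eigenvalues in an affine coordinate -/

/-- The eigenvalue can be read in any affine coordinate: if `t ↦ [p₁ t + q₁ : p₂ t + q₂]`
conjugates `H` to `h` near a fixed point `t₀` of `H`, the eigenvalue of `h` there is the
derivative of `H` at `t₀`. -/
lemma eigenvalue_ratio_eq {h : Sphere → Sphere} {H : ℂ → ℂ} {D t₀ p₁ q₁ p₂ q₂ : ℂ}
    (hdet : p₁ * q₂ - q₁ * p₂ ≠ 0) (hH : HasDerivAt H D t₀) (hfix : H t₀ = t₀)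
    (hconj : ∀ᶠ t in 𝓝 t₀, h (ratio (p₁ * t + q₁) (p₂ * t + q₂)) =
      ratio (p₁ * H t + q₁) (p₂ * H t + q₂)) :
    eigenvalue h (ratio (p₁ * t₀ + q₁) (p₂ * t₀ + q₂)) = D := by
  -- In either chart `e`, the local form of `h` is `e ∘ H ∘ e⁻¹` with `e` a Möbius map.
  have key : ∀ (f : ℂ → ℂ) (a₁ b₁ a₂ b₂ : ℂ), a₁ * b₂ - b₁ * a₂ ≠ 0 → a₂ * t₀ + b₂ ≠ 0 →
      (∀ w t : ℂ, a₁ * t + b₁ = w * (a₂ * t + b₂) → a₂ * t + b₂ ≠ 0 →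
        h (ratio (p₁ * t + q₁) (p₂ * t + q₂)) = ratio (p₁ * H t + q₁) (p₂ * H t + q₂) →
        f w = (a₁ * H t + b₁) / (a₂ * H t + b₂)) →
      deriv f ((a₁ * t₀ + b₁) / (a₂ * t₀ + b₂)) = D := by
    intro f a₁ b₁ a₂ b₂ hd hne hf
    set w₀ := (a₁ * t₀ + b₁) / (a₂ * t₀ + b₂) with hw₀
    have hw₀' : a₁ - a₂ * w₀ = (a₁ * b₂ - b₁ * a₂) / (a₂ * t₀ + b₂) := by
      rw [hw₀]; field_simp; ring
    have hden : a₁ - a₂ * w₀ ≠ 0 := by rw [hw₀']; exact div_ne_zero hd hne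
    have hwm : w₀ * (a₂ * t₀ + b₂) = a₁ * t₀ + b₁ := div_mul_cancel₀ _ hne
    set φ : ℂ → ℂ := fun w => (b₂ * w - b₁) / (a₁ - a₂ * w) with hφ
    have hφ₀ : φ w₀ = t₀ := by
      simp only [hφ]
      rw [div_eq_iff hden]
      linear_combination hwm
    have hφd : HasDerivAt φ ((b₂ * (a₁ - a₂ * w₀) - (b₂ * w₀ - b₁) * (-a₂)) / (a₁ - a₂ * w₀) ^ 2)
        w₀ := by
      have h1 : HasDerivAt (fun w : ℂ => b₂ * w - b₁) b₂ w₀ := by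
        simpa using ((hasDerivAt_id w₀).const_mul b₂).sub_const b₁
      have h2 : HasDerivAt (fun w : ℂ => a₁ - a₂ * w) (-a₂) w₀ := by
        simpa using ((hasDerivAt_id w₀).const_mul a₂).const_sub a₁
      exact h1.div h2 hden
    have hEd : HasDerivAt (fun t => (a₁ * t + b₁) / (a₂ * t + b₂))
        ((a₁ * (a₂ * t₀ + b₂) - (a₁ * t₀ + b₁) * a₂) / (a₂ * t₀ + b₂) ^ 2) (H t₀) := by
      have h1 : HasDerivAt (fun w : ℂ => a₁ * w + b₁) a₁ t₀ := by
        simpa using ((hasDerivAt_id t₀).const_mul a₁).add_const b₁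
      have h2 : HasDerivAt (fun w : ℂ => a₂ * w + b₂) a₂ t₀ := by
        simpa using ((hasDerivAt_id t₀).const_mul a₂).add_const b₂
      rw [hfix]
      exact h1.div h2 hne
    have hcomp : HasDerivAt (fun w => (a₁ * H (φ w) + b₁) / (a₂ * H (φ w) + b₂)) D w₀ := by
      rw [← hφ₀] at hH
      have h3 := hH.comp w₀ hφd
      have h4 : H t₀ = (H ∘ φ) w₀ := by simp [hφ₀]
      rw [h4] at hEd
      refine (hEd.comp w₀ h3).congr_deriv ?_
      have e1 : a₁ * (a₂ * t₀ + b₂) - (a₁ * t₀ + b₁) * a₂ =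
          (a₂ * t₀ + b₂) * (a₁ - a₂ * w₀) := by linear_combination a₂ * hwm
      have e2 : b₂ * (a₁ - a₂ * w₀) - (b₂ * w₀ - b₁) * (-a₂) =
          (a₂ * t₀ + b₂) * (a₁ - a₂ * w₀) := by linear_combination a₂ * hwm
      rw [e1, e2]
      generalize a₂ * t₀ + b₂ = N at hne
      generalize a₁ - a₂ * w₀ = c at hden
      field_simp
    have hev : f =ᶠ[𝓝 w₀] fun w => (a₁ * H (φ w) + b₁) / (a₂ * H (φ w) + b₂) := by
      have hc : ContinuousAt φ w₀ := hφd.continuousAt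
      have hc' : Tendsto φ (𝓝 w₀) (𝓝 t₀) := by simpa [ContinuousAt, hφ₀] using hc
      have hden' : ∀ᶠ w in 𝓝 w₀, a₁ - a₂ * w ≠ 0 := by
        have : ContinuousAt (fun w : ℂ => a₁ - a₂ * w) w₀ := by fun_prop
        exact this.eventually_ne hden
      filter_upwards [hc'.eventually hconj, hden'] with w hw hwd
      have hφw : φ w * (a₁ - a₂ * w) = b₂ * w - b₁ := div_mul_cancel₀ _ hwd
      have hden2 : a₂ * φ w + b₂ ≠ 0 := fun h0 => hd (by
        linear_combination (a₁ - a₂ * w) * h0 - a₂ * hφw)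
      exact hf w (φ w) (by linear_combination hφw) hden2 hw
    rw [hev.deriv_eq]
    exact hcomp.deriv
  by_cases hy : p₂ * t₀ + q₂ = 0
  · have hx : p₁ * t₀ + q₁ ≠ 0 := by
      intro hx
      apply hdet
      by_cases hp : p₂ = 0
      · have : q₂ = 0 := by simpa [hp] using hy
        simp [hp, this]
      · apply mul_left_cancel₀ hp
        linear_combination p₁ * p₂ * hy - p₂ * p₂ * hx
    have h0 : localCoord (ratio (p₁ * t₀ + q₁) (p₂ * t₀ + q₂)) =
        (p₂ * t₀ + q₂) / (p₁ * t₀ + q₁) := by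
      rw [hy, ratio_zero_right, zero_div]; rfl
    have hr : ratio (p₁ * t₀ + q₁) (p₂ * t₀ + q₂) = OnePoint.infty := by
      rw [hy, ratio_zero_right]
    rw [eigenvalue, h0, hr]
    refine key _ p₂ q₂ p₁ q₁ (fun h => hdet (by linear_combination -h)) hx ?_
    intro w t h1 h2 h3
    change coord (inversion (h (inversion (w : OnePoint ℂ)))) = _
    rw [inversion_coe, ← ratio_mul_left h2 1 w, mul_one, mul_comm _ w, ← h1, h3,
      coord_inversion_ratio]
  · have hr := ratio_of_ne (x := p₁ * t₀ + q₁) hy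
    rw [eigenvalue, hr]
    change deriv (fun w : ℂ => coord (h (w : OnePoint ℂ))) ((p₁ * t₀ + q₁) / (p₂ * t₀ + q₂)) = D
    refine key _ p₁ q₁ p₂ q₂ hdet hy ?_
    intro w t h1 h2 h3
    have : (w : OnePoint ℂ) = ratio (p₁ * t + q₁) (p₂ * t + q₂) := by
      rw [ratio_of_ne h2, h1, mul_div_cancel_right₀ _ h2]
    simp only [this, h3, coord_ratio]

/-- A multiple fixed point has eigenvalue `1`. -/
lemma eigenvalue_eq_one_of_two_le {h : Sphere → Sphere} {ζ : Sphere}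
    (hm : 2 ≤ fixedMultiplicity h ζ) : eigenvalue h ζ = 1 := by
  unfold fixedMultiplicity at hm
  split_ifs at hm with hζ
  · set f : ℂ → ℂ := fun w => w - localForm h ζ w with hf
    have han : AnalyticAt ℂ f (localCoord ζ) := by
      by_contra hna
      rw [analyticOrderAt_of_not_analyticAt hna] at hm
      simp at hm
    obtain ⟨u, hu, hfu⟩ := (natCast_le_analyticOrderAt (n := 2) han).1 (by exact_mod_cast hm)
    -- `f` vanishes to second order
    have hd : HasDerivAt f 0 (localCoord ζ) := by
      have h1 := (((hasDerivAt_id (localCoord ζ)).sub_const (localCoord ζ)).pow 2).mul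
        hu.differentiableAt.hasDerivAt
      refine (h1.congr_deriv (by simp)).congr_of_eventuallyEq ?_
      filter_upwards [hfu] with w hw
      simpa using hw
    have h3 : HasDerivAt (localForm h ζ) 1 (localCoord ζ) := by
      have := (hasDerivAt_id (localCoord ζ)).sub hd
      have e : (id - f) = localForm h ζ := by ext w; simp [hf]
      simpa only [e, sub_zero] using this
    exact h3.deriv
  · simp at hm

/-! ### The normal form -/

namespace QuadraticRationalMap

variable (g : QuadraticRationalMap)

/-- The numerator of a quadratic rational map, as a quadratic form. -/
def num (x y : ℂ) : ℂ := g.A₂ * x ^ 2 + g.A₁ * (x * y) + g.A₀ * y ^ 2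

/-- The denominator of a quadratic rational map, as a quadratic form. -/
def den (x y : ℂ) : ℂ := g.B₂ * x ^ 2 + g.B₁ * (x * y) + g.B₀ * y ^ 2

/-- The numerator and the denominator have no common zero: at one, `(x³, x² y, x y², y³)` would be
in the kernel of the Sylvester matrix. -/
lemma num_ne_zero_or_den_ne_zero {x y : ℂ} (h : x ≠ 0 ∨ y ≠ 0) :
    g.num x y ≠ 0 ∨ g.den x y ≠ 0 := by
  by_contra! hc
  obtain ⟨h1, h2⟩ := hc
  unfold num at h1
  unfold den at h2
  have := Matrix.eq_zero_of_mulVec_eq_zero g.resultant_ne_zero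
    (v := ![x ^ 3, x ^ 2 * y, x * y ^ 2, y ^ 3]) (by
      ext i
      fin_cases i <;> simp [Matrix.mulVec, dotProduct, Fin.sum_univ_four]
      · linear_combination x * h1
      · linear_combination y * h1
      · linear_combination x * h2
      · linear_combination y * h2)
  have hx := congrFun this 0
  have hy := congrFun this 3
  simp at hx hy
  simp [hx, hy] at h

lemma apply_ratio {x y : ℂ} (h : x ≠ 0 ∨ y ≠ 0) :
    g (ratio x y) = ratio (g.num x y) (g.den x y) := by
  by_cases hy : y = 0
  · subst hy
    have hx : x ≠ 0 := by simpa using h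
    rw [ratio_zero_right]
    change ratio g.A₂ g.B₂ = _
    rw [← ratio_mul_left (pow_ne_zero 2 hx)]
    simp [num, den, mul_comm]
  · rw [ratio_of_ne hy]
    change ratio (g.A₂ * (x / y) ^ 2 + g.A₁ * (x / y) + g.A₀)
      (g.B₂ * (x / y) ^ 2 + g.B₁ * (x / y) + g.B₀) = _
    rw [← ratio_mul_left (pow_ne_zero 2 hy)]
    unfold num den
    congr 1 <;> field_simp

end QuadraticRationalMap

/-- The quadratic rational map `t ↦ t (t + α) / (β t + 1)`, which fixes `0` and `∞` with
eigenvalues `α` and `β`, on the affine line. -/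
noncomputable def normalMap (α β t : ℂ) : ℂ := t * (t + α) / (β * t + 1)

/-- The derivative of `normalMap α β`. -/
noncomputable def normalDeriv (α β t : ℂ) : ℂ := (β * t ^ 2 + 2 * t + α) / (β * t + 1) ^ 2

lemma hasDerivAt_normalMap {α β t : ℂ} (h : β * t + 1 ≠ 0) :
    HasDerivAt (normalMap α β) (normalDeriv α β t) t := by
  have h1 : HasDerivAt (fun t : ℂ => t * (t + α)) (1 * (t + α) + t * 1) t :=
    (hasDerivAt_id t).mul ((hasDerivAt_id t).add_const α)
  have h2 : HasDerivAt (fun t : ℂ => β * t + 1) β t := by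
    simpa using ((hasDerivAt_id t).const_mul β).add_const 1
  refine (h1.div h2 h).congr_deriv ?_
  unfold normalDeriv
  ring

/-- `g` is `normalMap α β` in the affine coordinate `t` on the sphere for which `t` stands for
the point `[p₁ t + q₁ : p₂ t + q₂]`; this is expressed in homogeneous coordinates. -/
structure IsNormalForm (g : QuadraticRationalMap) (α β p₁ q₁ p₂ q₂ : ℂ) : Prop where
  det_ne_zero : p₁ * q₂ - q₁ * p₂ ≠ 0
  eps_ne_zero : 1 - α * β ≠ 0
  conj : ∀ x y : ℂ, (x ≠ 0 ∨ y ≠ 0) → g (ratio (p₁ * x + q₁ * y) (p₂ * x + q₂ * y)) =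
    ratio (p₁ * (x * (x + α * y)) + q₁ * (y * (β * x + y)))
      (p₂ * (x * (x + α * y)) + q₂ * (y * (β * x + y)))

lemma ne_zero_or_ne_zero_of_det {p₁ q₁ p₂ q₂ x y : ℂ} (hdet : p₁ * q₂ - q₁ * p₂ ≠ 0)
    (h : x ≠ 0 ∨ y ≠ 0) : p₁ * x + q₁ * y ≠ 0 ∨ p₂ * x + q₂ * y ≠ 0 := by
  by_contra! hc
  have hx : (p₁ * q₂ - q₁ * p₂) * x = 0 := by linear_combination q₂ * hc.1 - q₁ * hc.2
  have hy : (p₁ * q₂ - q₁ * p₂) * y = 0 := by linear_combination p₁ * hc.2 - p₂ * hc.1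
  simp [hdet] at hx hy
  simp [hx, hy] at h

namespace IsNormalForm

variable {g : QuadraticRationalMap} {α β p₁ q₁ p₂ q₂ : ℂ}

/-- Exchanging the two normalized fixed points, by `t ↦ 1 / t`. -/
lemma swap (hg : IsNormalForm g α β p₁ q₁ p₂ q₂) : IsNormalForm g β α q₁ p₁ q₂ p₂ where
  det_ne_zero h := hg.det_ne_zero (by linear_combination -h)
  eps_ne_zero h := hg.eps_ne_zero (by linear_combination h)
  conj x y h := by
    have := hg.conj y x h.symm
    rw [add_comm (q₁ * x), add_comm (q₂ * x), this]
    congr 1 <;> ring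

lemma apply_ratio (hg : IsNormalForm g α β p₁ q₁ p₂ q₂) {t : ℂ} (ht : β * t + 1 ≠ 0) :
    g (ratio (p₁ * t + q₁) (p₂ * t + q₂)) =
      ratio (p₁ * normalMap α β t + q₁) (p₂ * normalMap α β t + q₂) := by
  have := hg.conj t 1 (by simp)
  simp only [mul_one, one_mul] at this
  rw [this, ← ratio_mul_left ht (p₁ * normalMap α β t + q₁)]
  have hm : (β * t + 1) * normalMap α β t = t * (t + α) := mul_div_cancel₀ _ ht
  congr 1
  · linear_combination -p₁ * hm
  · linear_combination -p₂ * hm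

lemma eventually_apply_ratio (hg : IsNormalForm g α β p₁ q₁ p₂ q₂) {t : ℂ} (ht : β * t + 1 ≠ 0) :
    ∀ᶠ s in 𝓝 t, g (ratio (p₁ * s + q₁) (p₂ * s + q₂)) =
      ratio (p₁ * normalMap α β s + q₁) (p₂ * normalMap α β s + q₂) := by
  have : ContinuousAt (fun s : ℂ => β * s + 1) t := by fun_prop
  filter_upwards [this.eventually_ne ht] with s hs using hg.apply_ratio hs

lemma eigenvalue_of_fixed (hg : IsNormalForm g α β p₁ q₁ p₂ q₂) {t : ℂ} (ht : β * t + 1 ≠ 0)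
    (hfix : normalMap α β t = t) :
    eigenvalue g (ratio (p₁ * t + q₁) (p₂ * t + q₂)) = normalDeriv α β t :=
  eigenvalue_ratio_eq hg.det_ne_zero (hasDerivAt_normalMap ht) hfix (hg.eventually_apply_ratio ht)

lemma eigenvalue_zero (hg : IsNormalForm g α β p₁ q₁ p₂ q₂) :
    eigenvalue g (ratio q₁ q₂) = α := by
  have := hg.eigenvalue_of_fixed (t := 0) (by simp) (by simp [normalMap])
  simpa [normalDeriv] using this

lemma apply_zero (hg : IsNormalForm g α β p₁ q₁ p₂ q₂) : g (ratio q₁ q₂) = ratio q₁ q₂ := by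
  simpa [normalMap] using hg.apply_ratio (t := 0) (by simp)

/-- A point other than the two normalized fixed points has a nonzero affine coordinate. -/
lemma exists_coordinate (hg : IsNormalForm g α β p₁ q₁ p₂ q₂) {ζ : Sphere}
    (h₀ : ζ ≠ ratio q₁ q₂) (h₁ : ζ ≠ ratio p₁ p₂) :
    ∃ t : ℂ, t ≠ 0 ∧ ζ = ratio (p₁ * t + q₁) (p₂ * t + q₂) := by
  obtain ⟨u, v, huv, rfl⟩ := exists_ratio_eq ζ
  have hq : q₁ ≠ 0 ∨ q₂ ≠ 0 := by
    simpa using ne_zero_or_ne_zero_of_det (x := 0) (y := 1) hg.det_ne_zero (by simp)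
  have hp : p₁ ≠ 0 ∨ p₂ ≠ 0 := by
    simpa using ne_zero_or_ne_zero_of_det (x := 1) (y := 0) hg.det_ne_zero (by simp)
  rw [Ne, ratio_eq_ratio_iff huv hq, ← sub_eq_zero] at h₀
  rw [Ne, ratio_eq_ratio_iff huv hp, ← sub_eq_zero] at h₁
  have hne : p₁ * v - p₂ * u ≠ 0 := fun h => h₁ (by linear_combination -h)
  refine ⟨(u * q₂ - q₁ * v) / (p₁ * v - p₂ * u), div_ne_zero h₀ hne, ?_⟩
  have hd := hg.det_ne_zero
  rw [← ratio_mul_left hd u v, ← ratio_mul_left hne (p₁ * _ + q₁)]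
  congr 1 <;> field_simp <;> ring

/-- The relation between the three eigenvalues at the fixed points (a form of the holomorphic
fixed point formula). -/
lemma eigenvalue_mul_eps (hg : IsNormalForm g α β p₁ q₁ p₂ q₂) {ζ : Sphere} (hζ : g ζ = ζ)
    (h₀ : ζ ≠ ratio q₁ q₂) (h₁ : ζ ≠ ratio p₁ p₂) :
    eigenvalue g ζ * (1 - α * β) = 2 - α - β := by
  obtain ⟨t, ht, rfl⟩ := hg.exists_coordinate h₀ h₁
  have hε := hg.eps_ne_zero
  have hd := hg.det_ne_zero
  -- comparing both sides of `g ζ = ζ` in homogeneous coordinates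
  have hlin : t + α = β * t + 1 := by
    have h := hg.conj t 1 (by simp)
    simp only [mul_one, one_mul] at h
    rw [h, ratio_eq_ratio_iff] at hζ
    · have : (p₁ * q₂ - q₁ * p₂) * (t * ((t + α) - (β * t + 1))) = 0 := by
        linear_combination hζ
      simp only [mul_eq_zero, hd, ht, false_or] at this
      linear_combination this
    · refine ne_zero_or_ne_zero_of_det hd ?_
      by_contra! hc
      have h1 : t + α = 0 := by simpa [ht] using hc.1
      exact hε (by linear_combination hc.2 - β * h1)
    · simpa using ne_zero_or_ne_zero_of_det hd (x := t) (y := 1) (by simp)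
  have hne : β * t + 1 ≠ 0 := by
    intro h
    rw [h] at hlin
    exact hε (by linear_combination h - β * hlin)
  rw [hg.eigenvalue_of_fixed hne (by unfold normalMap; rw [hlin, mul_div_cancel_right₀ _ hne])]
  unfold normalDeriv
  rw [div_mul_eq_mul_div, div_eq_iff (pow_ne_zero 2 hne)]
  have hα : α = β * t + 1 - t := by linear_combination hlin
  subst hα
  ring

/-- A cycle of exact period `n > 1` in normal form: it lies in the punctured affine line and its
eigenvalue is the product of the derivatives. -/
lemma exists_cycle (hg : IsNormalForm g α β p₁ q₁ p₂ q₂) {n : ℕ} (hn : 1 < n) {ζ : Sphere}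
    (hζ : Function.minimalPeriod g ζ = n) :
    ∃ t : ℕ → ℂ, (∀ i, t i ≠ 0) ∧ (∀ i, β * t i + 1 ≠ 0) ∧
      (∀ i, t (i + 1) = normalMap α β (t i)) ∧ (∀ i, t (i + n) = t i) ∧
      eigenvalue (g^[n]) ζ = ∏ i ∈ Finset.range n, normalDeriv α β (t i) := by
  have hd := hg.det_ne_zero
  have hper : ζ ∈ Function.periodicPts g := by
    rw [← Function.minimalPeriod_pos_iff_mem_periodicPts]; omega
  have hnf : ∀ i, g (g^[i] ζ) ≠ g^[i] ζ := by
    intro i h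
    have h1 := Function.minimalPeriod_apply_iterate hper i
    have h2 : Function.minimalPeriod g (g^[i] ζ) = 1 :=
      Function.minimalPeriod_eq_one_iff_isFixedPt.2 h
    omega
  have h₀ : ∀ i, g^[i] ζ ≠ ratio q₁ q₂ := fun i h => hnf i (by rw [h, hg.apply_zero])
  have h₁ : ∀ i, g^[i] ζ ≠ ratio p₁ p₂ := fun i h => hnf i (by rw [h, hg.swap.apply_zero])
  choose t ht0 ht using fun i => hg.exists_coordinate (h₀ i) (h₁ i)
  -- a pole of the normal form would be sent to the fixed point at infinity
  have hne : ∀ i, β * t i + 1 ≠ 0 := by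
    intro i h
    apply h₁ (i + 1)
    rw [Function.iterate_succ_apply', ht i]
    have h2 := hg.conj (t i) 1 (by simp)
    simp only [mul_one, h, mul_zero, add_zero] at h2
    have hk : t i * (t i + α) ≠ 0 := by
      refine mul_ne_zero (ht0 i) fun h3 => hg.eps_ne_zero ?_
      linear_combination h - β * h3
    rw [h2, mul_comm p₁, mul_comm p₂, ratio_mul_left hk]
  have hinj : ∀ s s' : ℂ, ratio (p₁ * s + q₁) (p₂ * s + q₂) = ratio (p₁ * s' + q₁) (p₂ * s' + q₂) →
      s = s' := by
    intro s s' h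
    rw [ratio_eq_ratio_iff] at h
    · have : (p₁ * q₂ - q₁ * p₂) * (s - s') = 0 := by linear_combination h
      simpa [hd, sub_eq_zero] using this
    · simpa using ne_zero_or_ne_zero_of_det hd (x := s) (y := 1) (by simp)
    · simpa using ne_zero_or_ne_zero_of_det hd (x := s') (y := 1) (by simp)
  have hstep : ∀ i, t (i + 1) = normalMap α β (t i) := by
    intro i
    apply hinj
    rw [← ht (i + 1), Function.iterate_succ_apply', ← hg.apply_ratio (hne i), ← ht i]
  have hcyc : ∀ i, t (i + n) = t i := by
    intro i
    apply hinj
    rw [← ht, ← ht, Function.iterate_add_apply, ← hζ, Function.iterate_minimalPeriod]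
  have hiter : ∀ i, (normalMap α β)^[i] (t 0) = t i := by
    intro i
    induction i with
    | zero => rfl
    | succ i ih => rw [Function.iterate_succ_apply', ih, hstep]
  have hder : ∀ i, HasDerivAt (normalMap α β)^[i]
      (∏ j ∈ Finset.range i, normalDeriv α β (t j)) (t 0) := by
    intro i
    induction i with
    | zero => simpa using hasDerivAt_id (t 0)
    | succ i ih =>
      rw [Function.iterate_succ', Finset.prod_range_succ, mul_comm]
      refine HasDerivAt.comp (t 0) ?_ ih
      rw [hiter]
      exact hasDerivAt_normalMap (hne i)
  have hconj : ∀ i, ∀ᶠ s in 𝓝 (t 0), g^[i] (ratio (p₁ * s + q₁) (p₂ * s + q₂)) =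
      ratio (p₁ * (normalMap α β)^[i] s + q₁) (p₂ * (normalMap α β)^[i] s + q₂) := by
    intro i
    induction i with
    | zero => simp
    | succ i ih =>
      have hc : Tendsto (normalMap α β)^[i] (𝓝 (t 0)) (𝓝 (t i)) := by
        simpa [ContinuousAt, hiter] using (hder i).continuousAt
      filter_upwards [ih, hc.eventually (hg.eventually_apply_ratio (hne i))] with s h1 h2
      rw [Function.iterate_succ_apply', Function.iterate_succ_apply', h1, h2]
  refine ⟨t, ht0, hne, hstep, hcyc, ?_⟩
  have hζ0 : ζ = ratio (p₁ * t 0 + q₁) (p₂ * t 0 + q₂) := ht 0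
  rw [hζ0]
  refine eigenvalue_ratio_eq hd (hder n) ?_ (hconj n)
  rw [hiter]
  simpa using hcyc 0

end IsNormalForm

/-- Two distinct fixed points can be moved to `0` and `∞`. -/
lemma exists_isNormalForm (g : QuadraticRationalMap) {a b : Sphere} (ha : g a = a) (hb : g b = b)
    (hab : a ≠ b) : ∃ p₁ q₁ p₂ q₂ : ℂ, a = ratio q₁ q₂ ∧ b = ratio p₁ p₂ ∧
      IsNormalForm g (eigenvalue g a) (eigenvalue g b) p₁ q₁ p₂ q₂ := by
  obtain ⟨q₁, q₂, hq, rfl⟩ := exists_ratio_eq a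
  obtain ⟨p₁, p₂, hp, rfl⟩ := exists_ratio_eq b
  rw [Ne, ratio_eq_ratio_iff hq hp] at hab
  have hdet : p₁ * q₂ - q₁ * p₂ ≠ 0 := fun h => hab (by linear_combination -h)
  -- `[x : y]` fixed means that `(x, y)` is mapped to a nonzero multiple of itself
  have hmul : ∀ {x y : ℂ}, (x ≠ 0 ∨ y ≠ 0) → g (ratio x y) = ratio x y →
      ∃ s : ℂ, s ≠ 0 ∧ g.num x y = s * x ∧ g.den x y = s * y := by
    intro x y hxy h
    have h0 := g.num_ne_zero_or_den_ne_zero hxy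
    rw [g.apply_ratio hxy, ratio_eq_ratio_iff h0 hxy] at h
    rcases hxy with hx | hy
    · refine ⟨g.num x y / x, ?_, by field_simp, by field_simp; linear_combination -h⟩
      refine div_ne_zero (fun h1 => ?_) hx
      rw [h1, zero_mul, eq_comm, mul_eq_zero] at h
      tauto
    · refine ⟨g.den x y / y, ?_, by field_simp; linear_combination h, by field_simp⟩
      refine div_ne_zero (fun h1 => ?_) hy
      rw [h1, mul_zero, mul_eq_zero] at h
      tauto
  obtain ⟨s, hs, hs1, hs2⟩ := hmul hq ha
  obtain ⟨p, hpne, hp1, hp2⟩ := hmul hp hb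
  -- the polar form at the two fixed vectors, and its coordinates in the basis they form
  obtain ⟨m₁, hm₁⟩ : ∃ m, m = 2 * g.A₂ * p₁ * q₁ + g.A₁ * (p₁ * q₂ + q₁ * p₂) +
    2 * g.A₀ * p₂ * q₂ := ⟨_, rfl⟩
  obtain ⟨m₂, hm₂⟩ : ∃ m, m = 2 * g.B₂ * p₁ * q₁ + g.B₁ * (p₁ * q₂ + q₁ * p₂) +
    2 * g.B₀ * p₂ * q₂ := ⟨_, rfl⟩
  obtain ⟨q, r, hqr1, hqr2⟩ : ∃ q r : ℂ, m₁ = q * p₁ + r * q₁ ∧ m₂ = q * p₂ + r * q₂ := by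
    have h1 := div_mul_cancel₀ (m₁ * q₂ - m₂ * q₁) hdet
    have h2 := div_mul_cancel₀ (m₂ * p₁ - m₁ * p₂) hdet
    refine ⟨(m₁ * q₂ - m₂ * q₁) / (p₁ * q₂ - q₁ * p₂), (m₂ * p₁ - m₁ * p₂) / (p₁ * q₂ - q₁ * p₂),
      mul_left_cancel₀ hdet ?_, mul_left_cancel₀ hdet ?_⟩
    · linear_combination -p₁ * h1 - q₁ * h2
    · linear_combination -p₂ * h1 - q₂ * h2
  have hF1 : ∀ x y : ℂ, g.num (p₁ * x + q₁ * y) (p₂ * x + q₂ * y) =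
      x ^ 2 * (p * p₁) + x * y * (q * p₁ + r * q₁) + y ^ 2 * (s * q₁) := by
    intro x y
    rw [← hs1, ← hp1, ← hqr1, hm₁]
    unfold QuadraticRationalMap.num
    ring
  have hF2 : ∀ x y : ℂ, g.den (p₁ * x + q₁ * y) (p₂ * x + q₂ * y) =
      x ^ 2 * (p * p₂) + x * y * (q * p₂ + r * q₂) + y ^ 2 * (s * q₂) := by
    intro x y
    rw [← hs2, ← hp2, ← hqr2, hm₂]
    unfold QuadraticRationalMap.den
    ring
  have hdet' : s / p * p₁ * q₂ - q₁ * (s / p * p₂) ≠ 0 := by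
    have : s / p * p₁ * q₂ - q₁ * (s / p * p₂) = s / p * (p₁ * q₂ - q₁ * p₂) := by ring
    rw [this]
    exact mul_ne_zero (div_ne_zero hs hpne) hdet
  have hN : IsNormalForm g (q / s) (r / p) (s / p * p₁) q₁ (s / p * p₂) q₂ := by
    refine ⟨hdet', ?_, ?_⟩
    · -- if `q r = p s`, the numerator and the denominator have the common zero `(-q, p)`
      intro h
      have h1 : q * r = p * s := by field_simp at h; linear_combination -h
      have h2 := ne_zero_or_ne_zero_of_det hdet (x := -q) (y := p) (Or.inr hpne)
      have h3 := g.num_ne_zero_or_den_ne_zero h2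
      rw [hF1, hF2] at h3
      have e1 : (-q) ^ 2 * (p * p₁) + -q * p * (q * p₁ + r * q₁) + p ^ 2 * (s * q₁) = 0 := by
        linear_combination (-p * q₁) * h1
      have e2 : (-q) ^ 2 * (p * p₂) + -q * p * (q * p₂ + r * q₂) + p ^ 2 * (s * q₂) = 0 := by
        linear_combination (-p * q₂) * h1
      exact h3.elim (fun h => h e1) (fun h => h e2)
    · intro x y hxy
      have h2 := ne_zero_or_ne_zero_of_det hdet' hxy
      rw [g.apply_ratio h2, ← ratio_mul_left hs (s / p * p₁ * (x * (x + q / s * y)) + _)]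
      have e : ∀ u v : ℂ, s / p * u * x + v * y = u * (s / p * x) + v * y := fun u v => by ring
      rw [e, e, hF1, hF2]
      congr 1 <;> field_simp <;> ring
  have hb' : ratio (s / p * p₁) (s / p * p₂) = ratio p₁ p₂ :=
    ratio_mul_left (div_ne_zero hs hpne) _ _
  have e1 := hN.eigenvalue_zero
  have e2 := hN.swap.eigenvalue_zero
  rw [hb'] at e2
  refine ⟨s / p * p₁, q₁, s / p * p₂, q₂, rfl, hb'.symm, ?_⟩
  rwa [e1, e2]

/-! ### Cycles with bounded eigenvalue -/

/-- If a product of `n` factors `1 + u i` along a cycle is bounded, then either every `u i` is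
bounded, or there is a stretch of the cycle along which `u` is bounded and which joins two
indices at which `u` is bounded below: a factor that is large must be compensated by one that is
small, and for a small factor `u` is near `-1`. -/
lemma exists_bounded_stretch {n : ℕ} (hn : 1 ≤ n) {M : ℝ} {u : ℕ → ℂ}
    (hu : ∀ i, u (i + n) = u i) (hM : ‖∏ i ∈ Finset.range n, (1 + u i)‖ ≤ M) :
    ∃ j q : ℕ, 1 ≤ q ∧ q ≤ n ∧
      (∀ i, j ≤ i → i < j + q → ‖u i‖ ≤ 2 ^ n * (M + 1) + 2) ∧
      (q = n ∨ (1 / 2 ≤ ‖u j‖ ∧ 1 / 2 ≤ ‖u (j + q)‖)) := by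
  have hM0 : 0 ≤ M := (norm_nonneg _).trans hM
  have h2n : (1 : ℝ) ≤ 2 ^ n := one_le_pow₀ (by norm_num)
  set K : ℝ := 2 ^ n * (M + 1) + 2 with hK
  have hK2 : 2 ≤ K := by rw [hK]; nlinarith
  by_cases hall : ∀ i, ‖u i‖ ≤ K
  · exact ⟨0, n, hn, le_rfl, fun i _ _ => hall i, Or.inl rfl⟩
  push Not at hall
  obtain ⟨i₀, hi₀⟩ := hall
  have humod : ∀ i, u (i % n) = u i := by
    have hp : Function.Periodic u n := hu
    exact fun i => hp.map_mod_nat i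
  -- a factor larger than `K - 1` has to be compensated by a small one
  have hsmall : ∃ j, ‖1 + u j‖ < 1 / 2 := by
    by_contra! hc
    have hi₁ : i₀ % n ∈ Finset.range n := Finset.mem_range.2 (Nat.mod_lt _ (by omega))
    have h1 : K - 1 ≤ ‖1 + u (i₀ % n)‖ := by
      rw [humod]
      have := norm_sub_le (1 + u i₀) 1
      rw [add_sub_cancel_left, norm_one] at this
      linarith
    have h2 : (1 / 2 : ℝ) ^ n ≤ ∏ i ∈ (Finset.range n).erase (i₀ % n), ‖1 + u i‖ := by
      calc (1 / 2 : ℝ) ^ n ≤ (1 / 2 : ℝ) ^ ((Finset.range n).erase (i₀ % n)).card := by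
            refine pow_le_pow_of_le_one (by norm_num) (by norm_num) ?_
            exact (Finset.card_le_card (Finset.erase_subset _ _)).trans (by simp)
        _ = ∏ i ∈ (Finset.range n).erase (i₀ % n), (1 / 2 : ℝ) := by simp
        _ ≤ _ := Finset.prod_le_prod (fun _ _ => by norm_num) fun i _ => hc i
    rw [norm_prod, ← Finset.mul_prod_erase _ _ hi₁] at hM
    have h3 : (K - 1) * (1 / 2 : ℝ) ^ n ≤ M :=
      (mul_le_mul h1 h2 (by positivity) (norm_nonneg _)).trans hM
    rw [one_div, inv_pow, ← div_eq_mul_inv, div_le_iff₀ (by positivity)] at h3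
    rw [hK] at h3
    nlinarith
  obtain ⟨j, hj⟩ := hsmall
  have hjl : 1 / 2 ≤ ‖u j‖ := by
    have := norm_sub_le (1 + u j) (u j)
    rw [add_sub_cancel_right, norm_one] at this
    linarith
  have hju : ‖u j‖ ≤ K := by
    have := norm_sub_le (1 + u j) 1
    rw [add_sub_cancel_left, norm_one] at this
    linarith
  -- the first index after `j` at which `u` is large
  have hex : ∃ q, K < ‖u (j + q)‖ ∧ q ≤ n := by
    refine ⟨(i₀ + (n - 1) * j) % n, ?_, (Nat.mod_lt _ (by omega)).le⟩
    have hc : (j + (i₀ + (n - 1) * j) % n) % n = i₀ % n := by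
      rw [Nat.add_mod_mod]
      have : j + (i₀ + (n - 1) * j) = i₀ + n * j := by
        obtain ⟨m, rfl⟩ : ∃ m, n = m + 1 := ⟨n - 1, by omega⟩
        rw [Nat.add_sub_cancel]; ring
      rw [this, Nat.add_mul_mod_self_left]
    rw [← humod, hc, humod]
    exact hi₀
  classical
  obtain ⟨hq1, hq2⟩ := Nat.find_spec hex
  have hmin := fun m => Nat.find_min hex (m := m)
  set q := Nat.find hex
  have hq0 : 1 ≤ q := by
    by_contra h0
    have : q = 0 := by omega
    rw [this, add_zero] at hq1
    linarith
  refine ⟨j, q, hq0, hq2, fun i hi1 hi2 => ?_, Or.inr ⟨hjl, by linarith⟩⟩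
  by_contra h
  refine hmin (i - j) (by omega) ⟨?_, by omega⟩
  rw [Nat.add_sub_cancel' hi1]
  exact not_le.1 h

/-- A quadratic inequality whose coefficients are `O(e ^ 2)` makes `x` an `O(e)`. -/
lemma le_of_sq_le {x e P Q : ℝ} (he : 0 ≤ e) (he1 : e ≤ 1) (hP : 0 ≤ P) (hQ : 0 ≤ Q)
    (h : x ^ 2 ≤ P * e ^ 2 * x + Q * e ^ 2) : x ≤ (P + Q + 1) * e := by
  by_contra! hc
  have h0 : 0 ≤ (P + Q) * e := by positivity
  have hxe : e < x := by nlinarith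
  have hx : 0 < x := he.trans_lt hxe
  have h1 : (P + Q + 1) * e * x < x * x := mul_lt_mul_of_pos_right hc hx
  have h2 : P * e ^ 2 * x ≤ P * e * x := by
    have : e ^ 2 ≤ e := by nlinarith
    gcongr
  have h3 : Q * e ^ 2 ≤ Q * e * x := by
    have : e * e ≤ e * x := by gcongr
    nlinarith
  have h4 : 0 ≤ e * x := by positivity
  nlinarith

/-- A product of `q` factors close to `α` is close to `α ^ q`. -/
lemma norm_prod_sub_pow_le {w : ℕ → ℂ} {α : ℂ} {B d : ℝ} (hB : 1 ≤ B) (hα : ‖α‖ ≤ B)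
    (j q : ℕ) (hw : ∀ i, j ≤ i → i < j + q → ‖w i‖ ≤ B ∧ ‖w i - α‖ ≤ d) :
    ‖∏ i ∈ Finset.range q, w (j + i)‖ ≤ B ^ q ∧
      ‖∏ i ∈ Finset.range q, w (j + i) - α ^ q‖ ≤ q * B ^ q * d := by
  induction q with
  | zero => simp
  | succ q ih =>
    obtain ⟨h1, h2⟩ := ih fun i hi1 hi2 => hw i hi1 (by omega)
    obtain ⟨h3, h4⟩ := hw (j + q) (by omega) (by omega)
    have hd : 0 ≤ d := (norm_nonneg _).trans h4
    rw [Finset.prod_range_succ]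
    set p := ∏ i ∈ Finset.range q, w (j + i)
    constructor
    · rw [norm_mul, pow_succ]; gcongr
    · have e : p * w (j + q) - α ^ (q + 1) = p * (w (j + q) - α) + (p - α ^ q) * α := by ring
      rw [e]
      calc ‖p * (w (j + q) - α) + (p - α ^ q) * α‖
          ≤ ‖p‖ * ‖w (j + q) - α‖ + ‖p - α ^ q‖ * ‖α‖ := by
            rw [← norm_mul, ← norm_mul]; exact norm_add_le _ _
        _ ≤ B ^ q * d + q * B ^ q * d * B := by gcongr
        _ ≤ B ^ (q + 1) * d + q * B ^ q * d * B := by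
            gcongr
            omega
        _ = _ := by push_cast; ring

/-- `t G'(t) / G(t) - 1` for `G = normalMap α β`: the deviation from `1` of the derivative of `G`
in the coordinate `log t`. -/
noncomputable def logDeviation (α β t : ℂ) : ℂ := (1 - α * β) * t / ((t + α) * (β * t + 1))

/-- Along a cycle the ratios `t (i + 1) / t i` cancel from the product of the derivatives. -/
lemma prod_normalDeriv {α β : ℂ} {n : ℕ} {t : ℕ → ℂ} (h0 : ∀ i, t i ≠ 0)
    (h1 : ∀ i, β * t i + 1 ≠ 0) (hstep : ∀ i, t (i + 1) = normalMap α β (t i))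
    (hcyc : ∀ i, t (i + n) = t i) :
    ∏ i ∈ Finset.range n, normalDeriv α β (t i) =
      ∏ i ∈ Finset.range n, (1 + logDeviation α β (t i)) := by
  have hα : ∀ i, t i + α ≠ 0 := by
    intro i h
    apply h0 (i + 1)
    rw [hstep, normalMap, h]; simp
  have hfac : ∀ i, normalDeriv α β (t i) = t (i + 1) / t i * (1 + logDeviation α β (t i)) := by
    intro i
    have := h0 i
    have := h1 i
    have := hα i
    rw [hstep, normalMap, normalDeriv, logDeviation]
    field_simp
    ring
  -- the logarithmic part of the product telescopes
  have htel : ∀ m, ∏ i ∈ Finset.range m, t (i + 1) / t i = t m / t 0 := by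
    intro m
    induction m with
    | zero => simp [h0 0]
    | succ m ih =>
      rw [Finset.prod_range_succ, ih]
      have := h0 m
      have := h0 0
      field_simp
  rw [Finset.prod_congr rfl fun i _ => hfac i, Finset.prod_mul_distrib, htel]
  have : t n = t 0 := by simpa using hcyc 0
  rw [this, div_self (h0 0), one_mul]

/-- Where the deviation is bounded, `normalMap α β` is multiplication by `α + O(√|1 - α β|)`. -/
lemma norm_ratio_sub_le {α β t : ℂ} {A K : ℝ} (hαA : ‖α‖ ≤ A) (hβA : 1 ≤ A * ‖β‖)
    (hε : ‖1 - α * β‖ ≤ 1) (hα : t + α ≠ 0) (hβ : β * t + 1 ≠ 0)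
    (hK : ‖logDeviation α β t‖ ≤ K) :
    ‖(t + α) / (β * t + 1) - α‖ ≤ (A * (1 + K) + A * (K * A) + 1) * √‖1 - α * β‖ := by
  have hA : 0 ≤ A := (norm_nonneg _).trans hαA
  have hK0 : 0 ≤ K := (norm_nonneg _).trans hK
  set u := logDeviation α β t with hu
  set d := (t + α) / (β * t + 1) - α with hd
  set ε := 1 - α * β with hεd
  have hrel : β * d ^ 2 = ε * (1 - u) * d - u * ε * α := by
    rw [hd, hu, logDeviation, hεd]
    field_simp
    ring
  have hsq : √‖ε‖ ^ 2 = ‖ε‖ := Real.sq_sqrt (norm_nonneg _)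
  refine le_of_sq_le (Real.sqrt_nonneg _) (Real.sqrt_le_one.2 hε) (by positivity) (by positivity) ?_
  rw [hsq]
  have h1 : ‖β‖ * ‖d‖ ^ 2 ≤ ‖ε‖ * (1 + K) * ‖d‖ + K * ‖ε‖ * A := by
    rw [← norm_pow, ← norm_mul, hrel]
    refine (norm_sub_le _ _).trans ?_
    rw [norm_mul, norm_mul, norm_mul, norm_mul]
    have : ‖1 - u‖ ≤ 1 + K := (norm_sub_le _ _).trans (by rw [norm_one]; linarith)
    gcongr
  calc ‖d‖ ^ 2 ≤ A * ‖β‖ * ‖d‖ ^ 2 := le_mul_of_one_le_left (by positivity) hβA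
    _ = A * (‖β‖ * ‖d‖ ^ 2) := by ring
    _ ≤ A * (‖ε‖ * (1 + K) * ‖d‖ + K * ‖ε‖ * A) := by gcongr
    _ = _ := by ring

/-- Where the deviation is bounded below, `t` is within `O(√|1 - α β|)` of `-α`. -/
lemma norm_add_le_of_half_le {α β t : ℂ} {A : ℝ} (hαA : ‖α‖ ≤ A) (hβA : 1 ≤ A * ‖β‖)
    (hε : ‖1 - α * β‖ ≤ 1) (hα : t + α ≠ 0) (hβ : β * t + 1 ≠ 0)
    (hK : 1 / 2 ≤ ‖logDeviation α β t‖) :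
    ‖t + α‖ ≤ (A * 3 + A * (2 * A) + 1) * √‖1 - α * β‖ := by
  have hA : 0 ≤ A := (norm_nonneg _).trans hαA
  set s := t + α with hs
  set ε := 1 - α * β with hεd
  have hsq : √‖ε‖ ^ 2 = ‖ε‖ := Real.sq_sqrt (norm_nonneg _)
  refine le_of_sq_le (Real.sqrt_nonneg _) (Real.sqrt_le_one.2 hε) (by positivity) (by positivity) ?_
  rw [hsq]
  have h1 : ‖s‖ * ‖β * t + 1‖ ≤ 2 * (‖ε‖ * ‖t‖) := by
    have hpos : 0 < ‖s * (β * t + 1)‖ := norm_pos_iff.2 (mul_ne_zero hα hβ)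
    rw [logDeviation, norm_div, le_div_iff₀ hpos, norm_mul, norm_mul] at hK
    linarith
  have h2 : ‖t‖ ≤ ‖s‖ + A := by
    have : t = s - α := by rw [hs]; ring
    rw [this]
    exact (norm_sub_le _ _).trans (by linarith)
  have h3 : ‖β‖ * ‖s‖ ≤ ‖β * t + 1‖ + ‖ε‖ := by
    have : β * s = (β * t + 1) - ε := by rw [hs, hεd]; ring
    rw [← norm_mul, this]
    exact norm_sub_le _ _
  have h4 : ‖β‖ * ‖s‖ ^ 2 ≤ ‖ε‖ * 3 * ‖s‖ + 2 * ‖ε‖ * A := by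
    calc ‖β‖ * ‖s‖ ^ 2 = ‖s‖ * (‖β‖ * ‖s‖) := by ring
      _ ≤ ‖s‖ * (‖β * t + 1‖ + ‖ε‖) := by gcongr
      _ = ‖s‖ * ‖β * t + 1‖ + ‖s‖ * ‖ε‖ := by ring
      _ ≤ 2 * (‖ε‖ * ‖t‖) + ‖s‖ * ‖ε‖ := by gcongr
      _ ≤ 2 * (‖ε‖ * (‖s‖ + A)) + ‖s‖ * ‖ε‖ := by gcongr
      _ = _ := by ring
  calc ‖s‖ ^ 2 ≤ A * ‖β‖ * ‖s‖ ^ 2 := le_mul_of_one_le_left (by positivity) hβA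
    _ = A * (‖β‖ * ‖s‖ ^ 2) := by ring
    _ ≤ A * (‖ε‖ * 3 * ‖s‖ + 2 * ‖ε‖ * A) := by gcongr
    _ = _ := by ring

/-- A cycle of `normalMap α β` with bounded eigenvalue forces `α` to be close to a root of unity:
along a stretch of length `q`, `t` is multiplied by `α ^ q + O(√|1 - α β|)`, while it comes back
to within `O(√|1 - α β|)` of where it started. -/
lemma exists_norm_pow_sub_one_le {n : ℕ} (hn : 1 ≤ n) {A : ℝ} (hA : 1 ≤ A) (M : ℝ) :
    ∃ C : ℝ, ∀ (α β : ℂ) (t : ℕ → ℂ), ‖α‖ ≤ A → 1 ≤ A * ‖α‖ → 1 ≤ A * ‖β‖ →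
      ‖1 - α * β‖ ≤ 1 → (∀ i, t i ≠ 0) → (∀ i, β * t i + 1 ≠ 0) →
      (∀ i, t (i + 1) = normalMap α β (t i)) → (∀ i, t (i + n) = t i) →
      ‖∏ i ∈ Finset.range n, normalDeriv α β (t i)‖ ≤ M →
      ∃ q, 1 ≤ q ∧ q ≤ n ∧ ‖α ^ q - 1‖ ≤ C * √‖1 - α * β‖ := by
  by_cases hM0 : 0 ≤ M
  swap
  · refine ⟨0, fun α β t _ _ _ _ _ _ _ _ h => absurd ((norm_nonneg _).trans h) hM0⟩
  set K : ℝ := 2 ^ n * (M + 1) + 2 with hK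
  have hK0 : 0 ≤ K := by positivity
  set C₁ : ℝ := A * (1 + K) + A * (K * A) + 1 with hC₁
  set C₂ : ℝ := A * 3 + A * (2 * A) + 1 with hC₂
  set B : ℝ := A + C₁ with hB
  have hC₁0 : 0 ≤ C₁ := by positivity
  have hC₂0 : 0 ≤ C₂ := by positivity
  have hB1 : 1 ≤ B := by rw [hB]; linarith
  refine ⟨n * B ^ n * C₁ + A * (C₂ * (1 + B ^ n)), ?_⟩
  intro α β t hαA hAα hβA hε h0 h1 hstep hcyc hM
  set e := √‖1 - α * β‖ with he
  have he0 : 0 ≤ e := Real.sqrt_nonneg _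
  have he1 : e ≤ 1 := Real.sqrt_le_one.2 hε
  have hα : ∀ i, t i + α ≠ 0 := by
    intro i h
    apply h0 (i + 1)
    rw [hstep, normalMap, h]; simp
  rw [prod_normalDeriv h0 h1 hstep hcyc] at hM
  obtain ⟨j, q, hq1, hqn, hbd, hend⟩ :=
    exists_bounded_stretch hn (fun i => by rw [hcyc]) hM
  set w : ℕ → ℂ := fun i => (t i + α) / (β * t i + 1) with hw
  -- along the stretch, each step is nearly multiplication by `α`
  have hwα : ∀ i, j ≤ i → i < j + q → ‖w i‖ ≤ B ∧ ‖w i - α‖ ≤ C₁ * e := by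
    intro i hi1 hi2
    have h2 := norm_ratio_sub_le hαA hβA hε (hα i) (h1 i) (hbd i hi1 hi2)
    refine ⟨?_, h2⟩
    have h3 : ‖w i‖ ≤ ‖w i - α‖ + ‖α‖ := norm_le_norm_sub_add _ _
    have h4 : C₁ * e ≤ C₁ := mul_le_of_le_one_right hC₁0 he1
    rw [hB]; linarith
  obtain ⟨hp1, hp2⟩ := norm_prod_sub_pow_le hB1 (by linarith : ‖α‖ ≤ B) j q hwα
  have htel : ∀ m, t (j + m) = t j * ∏ i ∈ Finset.range m, w (j + i) := by
    intro m
    induction m with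
    | zero => simp
    | succ m ih =>
      rw [Finset.prod_range_succ, ← mul_assoc, ← ih, ← add_assoc, hstep, normalMap, hw,
        mul_div_assoc]
  set p := ∏ i ∈ Finset.range q, w (j + i) with hp
  have hBq : B ^ q ≤ B ^ n := pow_le_pow_right₀ hB1 hqn
  have hqn' : (q : ℝ) ≤ n := by exact_mod_cast hqn
  have hpow : ‖p - α ^ q‖ ≤ n * B ^ n * C₁ * e := by
    calc ‖p - α ^ q‖ ≤ q * B ^ q * (C₁ * e) := hp2
      _ ≤ n * B ^ n * (C₁ * e) := by gcongr
      _ = _ := by ring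
  -- the stretch closes up, or both of its ends are near `-α`
  have hret : ‖p - 1‖ ≤ A * (C₂ * (1 + B ^ n)) * e := by
    rcases hend with hq | ⟨hl, hr⟩
    · have : p = 1 := by
        have h2 := htel n
        rw [hcyc, ← hq] at h2
        exact mul_left_cancel₀ (h0 j) (by rw [mul_one]; exact h2.symm)
      rw [this, sub_self, norm_zero]
      positivity
    · have h2 := norm_add_le_of_half_le hαA hβA hε (hα j) (h1 j) hl
      have h3 := norm_add_le_of_half_le hαA hβA hε (hα (j + q)) (h1 (j + q)) hr
      have h4 : α * (p - 1) = (t j + α) * p - (t (j + q) + α) := by rw [htel q]; ring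
      have h5 : ‖α‖ * ‖p - 1‖ ≤ C₂ * e * B ^ n + C₂ * e := by
        rw [← norm_mul, h4]
        refine (norm_sub_le _ _).trans ?_
        rw [norm_mul]
        have : ‖p‖ ≤ B ^ n := hp1.trans hBq
        gcongr
      calc ‖p - 1‖ ≤ A * ‖α‖ * ‖p - 1‖ := le_mul_of_one_le_left (norm_nonneg _) hAα
        _ = A * (‖α‖ * ‖p - 1‖) := by ring
        _ ≤ A * (C₂ * e * B ^ n + C₂ * e) := by gcongr
        _ = _ := by ring
  refine ⟨q, hq1, hqn, ?_⟩
  have h6 : α ^ q - 1 = (p - 1) - (p - α ^ q) := by ring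
  rw [h6, add_mul]
  exact (norm_sub_le _ _).trans (by linarith)

/-! ### A double fixed point -/

/-- When the fixed point at `∞` is double, a cycle with bounded eigenvalue bounds the
eigenvalue `γ` at `0`. With `T = t + 1` and `D = γ - 1` the map is
`T ↦ T + D (1 - 1 / T)`, which moves by nearly `D` unless `T` is small. -/
lemma exists_norm_sub_one_le_of_double {n : ℕ} (hn : 1 ≤ n) (M : ℝ) :
    ∃ C : ℝ, ∀ (γ : ℂ) (t : ℕ → ℂ), (∀ i, 1 * t i + 1 ≠ 0) →
      (∀ i, t (i + 1) = normalMap γ 1 (t i)) → (∀ i, t (i + n) = t i) →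
      ‖∏ i ∈ Finset.range n, normalDeriv γ 1 (t i)‖ ≤ M → ‖γ - 1‖ ≤ C := by
  by_cases hM0 : 0 ≤ M
  swap
  · exact ⟨0, fun γ t _ _ _ h => absurd ((norm_nonneg _).trans h) hM0⟩
  set K : ℝ := 2 ^ n * (M + 1) + 2 with hK
  have hK0 : 0 ≤ K := by positivity
  refine ⟨(4 + n * √K) ^ 2, ?_⟩
  intro γ t h1 hstep hcyc hM
  set D := γ - 1 with hD
  set T : ℕ → ℂ := fun i => t i + 1 with hT
  have hT0 : ∀ i, T i ≠ 0 := fun i => by simpa using h1 i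
  have hTstep : ∀ i, T (i + 1) = T i + D - D / T i := by
    intro i
    have hne := hT0 i
    have hne' := h1 i
    have : t i = T i - 1 := by simp [hT]
    simp only [hT] at hne ⊢
    rw [hstep, normalMap, hD, one_mul]
    field_simp
    ring
  have hder : ∀ i, normalDeriv γ 1 (t i) = 1 + D / T i ^ 2 := by
    intro i
    have hne := hT0 i
    simp only [hT] at hne ⊢
    rw [normalDeriv, hD, one_mul, one_mul]
    field_simp
    ring
  simp only [hder] at hM
  obtain ⟨j, q, hq1, hqn, hbd, hend⟩ :=
    exists_bounded_stretch hn (u := fun i => D / T i ^ 2) (fun i => by simp only [hT, hcyc]) hM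
  set e := √‖D‖ with he
  have he0 : 0 ≤ e := Real.sqrt_nonneg _
  have hsq : e ^ 2 = ‖D‖ := Real.sq_sqrt (norm_nonneg _)
  have htel : ∀ m, T (j + m) = T j + m * D - ∑ i ∈ Finset.range m, D / T (j + i) := by
    intro m
    induction m with
    | zero => simp
    | succ m ih =>
      rw [← add_assoc, hTstep, Finset.sum_range_succ]
      nth_rewrite 1 [ih]
      push_cast; ring
  have hsum : ‖∑ i ∈ Finset.range q, D / T (j + i)‖ ≤ n * (√K * e) := by
    refine (norm_sum_le _ _).trans ?_
    have hterm : ∀ i ∈ Finset.range q, ‖D / T (j + i)‖ ≤ √K * e := by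
      intro i hi
      have hb := hbd (j + i) (by omega) (by have := Finset.mem_range.1 hi; omega)
      rw [he, ← Real.sqrt_mul hK0]
      refine Real.le_sqrt_of_sq_le ?_
      have : (D / T (j + i)) ^ 2 = D / T (j + i) ^ 2 * D := by
        rw [div_pow, sq D, div_mul_eq_mul_div]
      rw [← norm_pow, this, norm_mul]
      gcongr
    refine (Finset.sum_le_card_nsmul _ _ _ hterm).trans ?_
    rw [Finset.card_range, nsmul_eq_mul]
    have : (q : ℝ) ≤ n := by exact_mod_cast hqn
    gcongr
  -- the stretch closes up, or both of its ends are near `0`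
  have hdiff : ‖T (j + q) - T j‖ ≤ 4 * e := by
    rcases hend with hq | ⟨hl, hr⟩
    · have : T (j + q) = T j := by simp only [hT, hq, hcyc]
      rw [this, sub_self, norm_zero]; positivity
    · have hsm : ∀ i, 1 / 2 ≤ ‖D / T i ^ 2‖ → ‖T i‖ ≤ 2 * e := by
        intro i hi
        have hpos : 0 < ‖T i ^ 2‖ := norm_pos_iff.2 (pow_ne_zero 2 (hT0 i))
        rw [norm_div, le_div_iff₀ hpos, norm_pow] at hi
        refine abs_le_of_sq_le_sq' ?_ (by positivity) |>.2
        nlinarith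
      have := norm_sub_le (T (j + q)) (T j)
      linarith [hsm _ hl, hsm _ hr]
  have hqD : ‖(q : ℂ) * D‖ ≤ (4 + n * √K) * e := by
    have : (q : ℂ) * D = (T (j + q) - T j) + ∑ i ∈ Finset.range q, D / T (j + i) := by
      rw [htel q]; ring
    rw [this]
    refine (norm_add_le _ _).trans ?_
    linarith
  have hDle : e ^ 2 ≤ (4 + n * √K) * e := by
    rw [hsq]
    refine le_trans ?_ hqD
    rw [norm_mul, Complex.norm_natCast]
    exact le_mul_of_one_le_left (norm_nonneg _) (by exact_mod_cast hq1)
  rw [← hsq]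
  have hle : e ≤ 4 + n * √K := by
    rcases he0.eq_or_lt with h | h
    · rw [← h]; positivity
    · rw [pow_two] at hDle
      exact le_of_mul_le_mul_right hDle h
  gcongr

/-! ### An eigenvalue tending to infinity -/

/-- A cycle stays in `‖t‖ ≤ 2 ‖α‖`, since outside this disc `‖t‖` increases by at least `1` at each
step. -/
lemma norm_le_of_cycle {α β : ℂ} {n : ℕ} (hn : 1 ≤ n) {t : ℕ → ℂ} (h1 : ∀ i, β * t i + 1 ≠ 0)
    (hstep : ∀ i, t (i + 1) = normalMap α β (t i)) (hcyc : ∀ i, t (i + n) = t i)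
    (hα : 6 ≤ ‖α‖) (hβ : ‖β‖ ≤ 1 / 4) (i : ℕ) : ‖t i‖ ≤ 2 * ‖α‖ := by
  by_contra! hc
  have hgrow : ∀ m, ‖t i‖ + m ≤ ‖t (i + m)‖ := by
    intro m
    induction m with
    | zero => simp
    | succ m ih =>
      set s := t (i + m) with hs
      have hm0 : (0 : ℝ) ≤ m := Nat.cast_nonneg m
      have hs2 : 2 * ‖α‖ < ‖s‖ := by linarith
      have hden : ‖β * s + 1‖ ≤ ‖s‖ / 4 + 1 := by
        refine (norm_add_le _ _).trans ?_
        rw [norm_mul, norm_one]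
        nlinarith [norm_nonneg s]
      have hnum : ‖s‖ / 2 ≤ ‖s + α‖ := by
        have := norm_sub_le (s + α) α
        rw [add_sub_cancel_right] at this
        linarith
      have hpos : 0 < ‖β * s + 1‖ := norm_pos_iff.2 (h1 _)
      have hstep' : ‖s‖ + 1 ≤ ‖t (i + m + 1)‖ := by
        rw [hstep, normalMap, norm_div, norm_mul, le_div_iff₀ hpos]
        calc (‖s‖ + 1) * ‖β * s + 1‖ ≤ (‖s‖ + 1) * (‖s‖ / 4 + 1) := by gcongr
          _ ≤ ‖s‖ * (‖s‖ / 2) := by nlinarith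
          _ ≤ ‖s‖ * ‖s + α‖ := by gcongr
      rw [show i + (m + 1) = i + m + 1 from rfl]
      push_cast
      linarith
  have := hgrow n
  rw [hcyc] at this
  have hn' : (1 : ℝ) ≤ n := by exact_mod_cast hn
  linarith

/-- When `α` is near `∞` and `β` near `0`, the points of a cycle are near `0` or near `-α`, and
`normalMap α β` is strongly expanding there. -/
lemma le_norm_normalDeriv {α β t : ℂ} {η : ℝ} (hη : η ≤ 1 / 100) (hα : 1 ≤ η * ‖α‖)
    (hβ : ‖β‖ ≤ η) (h1 : β * t + 1 ≠ 0) (ht : ‖normalMap α β t‖ ≤ 2 * ‖α‖) :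
    1 ≤ 8 * η * ‖normalDeriv α β t‖ := by
  set a := ‖α‖ with ha
  have ha0 : 0 ≤ a := norm_nonneg _
  have hη0 : 0 ≤ η := (norm_nonneg _).trans hβ
  have ha100 : 100 ≤ a := by nlinarith
  set Q := β * t + 1 with hQ
  have hQpos : 0 < ‖Q‖ := norm_pos_iff.2 h1
  suffices h : ‖Q‖ ^ 2 ≤ 8 * η * ‖β * t ^ 2 + 2 * t + α‖ by
    rw [normalDeriv, norm_div, norm_pow, ← mul_div_assoc, le_div_iff₀ (by positivity), one_mul]
    exact h
  have hprod : ‖t‖ * ‖t + α‖ ≤ 2 * a * ‖Q‖ := by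
    rwa [normalMap, norm_div, norm_mul, div_le_iff₀ hQpos] at ht
  rcases le_total ‖t‖ (a / 2) with hta | hta
  · -- `t` near `0`
    have hs : a / 2 ≤ ‖t + α‖ := by
      have := norm_sub_le (t + α) t
      rw [add_sub_cancel_left] at this
      linarith
    have ht4 : ‖t‖ ≤ 4 * ‖Q‖ := by nlinarith [norm_nonneg t]
    have hQle : ‖Q‖ ≤ 1 + η * ‖t‖ := by
      have : ‖Q‖ ≤ ‖β * t‖ + 1 := by simpa using norm_add_le (β * t) 1
      rw [norm_mul] at this
      nlinarith [norm_nonneg t]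
    have ht5 : ‖t‖ ≤ 5 := by nlinarith [norm_nonneg t]
    have hQ2 : ‖Q‖ ≤ 5 / 4 := by nlinarith [norm_nonneg t]
    have hnum : a / 2 ≤ ‖β * t ^ 2 + 2 * t + α‖ := by
      have e1 : α = (β * t ^ 2 + 2 * t + α) - (β * t ^ 2 + 2 * t) := by ring
      have e2 : a ≤ ‖β * t ^ 2 + 2 * t + α‖ + ‖β * t ^ 2 + 2 * t‖ := by
        rw [ha]; nth_rewrite 1 [e1]; exact norm_sub_le _ _
      have e3 : ‖β * t ^ 2 + 2 * t‖ ≤ η * ‖t‖ ^ 2 + 2 * ‖t‖ := by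
        refine (norm_add_le _ _).trans ?_
        rw [norm_mul, norm_pow, norm_mul]
        simp only [RCLike.norm_ofNat]
        gcongr
      have e4 : η * ‖t‖ ^ 2 ≤ 1 / 100 * 5 ^ 2 := by gcongr
      linarith
    have : η * (a / 2) ≤ η * ‖β * t ^ 2 + 2 * t + α‖ := by gcongr
    nlinarith
  · -- `t` near `-α`
    set s := t + α with hs
    set ε := 1 - α * β with hε
    have hs4 : ‖s‖ ≤ 4 * ‖Q‖ := by
      have : a / 2 * ‖s‖ ≤ ‖t‖ * ‖s‖ := by gcongr
      have : a * ‖s‖ ≤ a * (4 * ‖Q‖) := by linarith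
      exact le_of_mul_le_mul_left this (by linarith)
    have hQle : ‖Q‖ ≤ η * ‖s‖ + ‖ε‖ := by
      have : Q = β * s + ε := by rw [hQ, hs, hε]; ring
      rw [this]
      refine (norm_add_le _ _).trans ?_
      rw [norm_mul]
      gcongr
    have hηs : η * ‖s‖ ≤ 1 / 100 * ‖s‖ := by gcongr
    have hs5 : ‖s‖ ≤ 5 * ‖ε‖ := by linarith [norm_nonneg ε]
    have hQ2 : ‖Q‖ ≤ 5 / 4 * ‖ε‖ := by linarith [norm_nonneg ε]
    have hεle : ‖ε‖ ≤ 2 * (η * a) := by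
      have : ‖ε‖ ≤ 1 + a * ‖β‖ := by
        rw [hε, ha, ← norm_mul]
        simpa using norm_sub_le 1 (α * β)
      have : a * ‖β‖ ≤ a * η := by gcongr
      linarith
    have hεa : ‖ε‖ ≤ a / 50 := by
      have : η * a ≤ 1 / 100 * a := by gcongr
      linarith
    have hnum : ‖ε‖ * (a / 2) ≤ ‖β * t ^ 2 + 2 * t + α‖ := by
      have e1 : α * ε = (β * s ^ 2 + 2 * s * ε) - (β * t ^ 2 + 2 * t + α) := by
        rw [hε, hs]; ring
      have e2 : a * ‖ε‖ ≤ ‖β * s ^ 2 + 2 * s * ε‖ + ‖β * t ^ 2 + 2 * t + α‖ := by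
        rw [ha, ← norm_mul, e1]; exact norm_sub_le _ _
      have e3 : ‖β * s ^ 2 + 2 * s * ε‖ ≤ η * ‖s‖ ^ 2 + 2 * ‖s‖ * ‖ε‖ := by
        refine (norm_add_le _ _).trans ?_
        rw [norm_mul, norm_pow, norm_mul, norm_mul]
        simp only [RCLike.norm_ofNat]
        gcongr
      have e4 : η * ‖s‖ ^ 2 ≤ 1 / 100 * (5 * ‖ε‖) ^ 2 := by gcongr
      have e5 : 2 * ‖s‖ * ‖ε‖ ≤ 2 * (5 * ‖ε‖) * ‖ε‖ := by gcongr
      have e6 : ‖ε‖ * ‖ε‖ ≤ ‖ε‖ * (a / 50) := by gcongr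
      nlinarith
    calc ‖Q‖ ^ 2 ≤ (5 / 4 * ‖ε‖) ^ 2 := by gcongr
      _ ≤ 2 * ‖ε‖ * ‖ε‖ := by nlinarith [norm_nonneg ε]
      _ ≤ 2 * ‖ε‖ * (2 * (η * a)) := by gcongr
      _ = 8 * η * (‖ε‖ * (a / 2)) := by ring
      _ ≤ _ := by gcongr

/-- A cycle of `normalMap α β` has large eigenvalue when `α` is near `∞` and `β` near `0`. -/
lemma exists_lt_norm_prod_normalDeriv {n : ℕ} (hn : 1 ≤ n) (M : ℝ) :
    ∃ η : ℝ, 0 < η ∧ ∀ (α β : ℂ) (t : ℕ → ℂ), 1 ≤ η * ‖α‖ → ‖β‖ ≤ η →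
      (∀ i, β * t i + 1 ≠ 0) → (∀ i, t (i + 1) = normalMap α β (t i)) →
      (∀ i, t (i + n) = t i) → M < ‖∏ i ∈ Finset.range n, normalDeriv α β (t i)‖ := by
  set L : ℝ := |M| + 100 with hL
  have hL0 : 100 ≤ L := by rw [hL]; linarith [abs_nonneg M]
  have hLM : M < L := by rw [hL]; linarith [le_abs_self M]
  refine ⟨1 / (8 * L), by positivity, fun α β t hα hβ h1 hstep hcyc => ?_⟩
  have hη : 1 / (8 * L) ≤ 1 / 100 := one_div_le_one_div_of_le (by norm_num) (by linarith)
  have hα6 : 6 ≤ ‖α‖ := by nlinarith [norm_nonneg α]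
  have hle := norm_le_of_cycle hn h1 hstep hcyc hα6 (by linarith)
  have hd : ∀ i, L ≤ ‖normalDeriv α β (t i)‖ := by
    intro i
    have h2 := le_norm_normalDeriv hη hα hβ (h1 i) (by rw [← hstep]; exact hle _)
    have e : 8 * (1 / (8 * L)) = L⁻¹ := by field_simp
    rw [e, inv_mul_eq_div, le_div_iff₀ (by linarith), one_mul] at h2
    exact h2
  calc M < L := hLM
    _ ≤ L ^ n := le_self_pow₀ (by linarith) (by omega)
    _ = ∏ i ∈ Finset.range n, L := by simp
    _ ≤ ∏ i ∈ Finset.range n, ‖normalDeriv α β (t i)‖ :=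
        Finset.prod_le_prod (fun _ _ => by linarith) fun i _ => hd i
    _ = _ := (norm_prod _ _).symm

/-! ### Sequences of maps -/

/-- If `α` is near `1` and `α - 1 = O(√|ε|)`, where `ε = 1 - α β`, then `γ` is bounded. Indeed the
relation between the three eigenvalues reads `γ ε = ε - s ^ 2 - γ ε s` with `s = α - 1`. -/
lemma norm_le_of_norm_sub_one_le {α β γ : ℂ} {C : ℝ} (hε : 1 - α * β ≠ 0)
    (hrel : γ * (1 - α * β) = 2 - α - β) (h : ‖α - 1‖ ≤ C * √‖1 - α * β‖) (hα : ‖α - 1‖ ≤ 1 / 2) :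
    ‖γ‖ ≤ 2 * (C ^ 2 + 1) := by
  set ε := 1 - α * β with hεd
  have hpos : 0 < ‖ε‖ := norm_pos_iff.2 hε
  have hsq : √‖ε‖ ^ 2 = ‖ε‖ := Real.sq_sqrt (norm_nonneg _)
  have h1 : ‖α - 1‖ ^ 2 ≤ C ^ 2 * ‖ε‖ := by
    calc ‖α - 1‖ ^ 2 ≤ (C * √‖ε‖) ^ 2 := by gcongr
      _ = C ^ 2 * ‖ε‖ := by rw [mul_pow, hsq]
  have h2 : γ * ε = ε - (α - 1) ^ 2 - γ * ε * (α - 1) := by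
    rw [hrel, hεd]; ring
  have h3 : ‖γ‖ * ‖ε‖ ≤ ‖ε‖ + C ^ 2 * ‖ε‖ + ‖γ‖ * ‖ε‖ * (1 / 2) := by
    calc ‖γ‖ * ‖ε‖ = ‖ε - (α - 1) ^ 2 - γ * ε * (α - 1)‖ := by rw [← norm_mul, ← h2]
      _ ≤ ‖ε‖ + ‖(α - 1) ^ 2‖ + ‖γ * ε * (α - 1)‖ :=
        (norm_sub_le _ _).trans (by gcongr; exact norm_sub_le _ _)
      _ ≤ _ := by
        rw [norm_pow, norm_mul, norm_mul]
        gcongr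
  have h4 : ‖γ‖ * ‖ε‖ ≤ 2 * (C ^ 2 + 1) * ‖ε‖ := by linarith
  exact le_of_mul_le_mul_right h4 hpos

/-- An eigenvalue of modulus greater than `1` at the fixed point `c` forces `c` to be simple. The
other two fixed points are then distinct and can be moved to `0` and `∞`, or they form a double
fixed point, of eigenvalue `1`, and `c` and this point can be moved to `0` and `∞`. -/
lemma exists_isNormalForm_or_double {g : QuadraticRationalMap} {a b c : Sphere}
    (hfix : IsFixedPointList g {a, b, c}) (hγ : 1 < ‖eigenvalue g c‖) :
    (∃ p₁ q₁ p₂ q₂ : ℂ,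
      IsNormalForm g (eigenvalue g a) (eigenvalue g b) p₁ q₁ p₂ q₂ ∧
      eigenvalue g c * (1 - eigenvalue g a * eigenvalue g b) =
        2 - eigenvalue g a - eigenvalue g b) ∨
    ∃ p₁ q₁ p₂ q₂ : ℂ, IsNormalForm g (eigenvalue g c) 1 p₁ q₁ p₂ q₂ := by
  classical
  have hmem : ∀ ζ : Sphere, ζ ∈ ({a, b, c} : Multiset Sphere) → g ζ = ζ := by
    intro ζ hζ
    by_contra hne
    have h := hfix ζ
    rw [fixedMultiplicity, if_neg hne] at h
    have h1 : 0 < Multiset.count ζ ({a, b, c} : Multiset Sphere) := Multiset.count_pos.2 hζ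
    have h2 : Multiset.count ζ ({a, b, c} : Multiset Sphere) = 0 := by
      rw [← Nat.cast_inj (R := ℕ∞)]; rw [Nat.cast_zero]; convert h.symm
    omega
  have hdouble : ∀ ζ : Sphere, 2 ≤ Multiset.count ζ ({a, b, c} : Multiset Sphere) →
      eigenvalue g ζ = 1 := by
    intro ζ hζ
    apply eigenvalue_eq_one_of_two_le
    rw [hfix ζ]
    have : ((2 : ℕ) : ℕ∞) ≤ (Multiset.count ζ ({a, b, c} : Multiset Sphere) : ℕ∞) := by
      exact_mod_cast hζ
    convert! this
  have ha := hmem a (by simp)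
  have hb := hmem b (by simp)
  have hc := hmem c (by simp)
  have hca : c ≠ a := by
    rintro rfl
    have := hdouble c (by
      simp only [Multiset.insert_eq_cons, Multiset.count_cons, Multiset.count_singleton]
      split_ifs <;> simp_all)
    simp [this] at hγ
  have hcb : c ≠ b := by
    rintro rfl
    have := hdouble c (by
      simp only [Multiset.insert_eq_cons, Multiset.count_cons, Multiset.count_singleton]
      split_ifs <;> simp_all)
    simp [this] at hγ
  by_cases hab : a = b
  · subst hab
    right
    have h1 := hdouble a (by
      simp only [Multiset.insert_eq_cons, Multiset.count_cons, Multiset.count_singleton]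
      split_ifs <;> simp_all)
    obtain ⟨p₁, q₁, p₂, q₂, -, -, h⟩ := exists_isNormalForm g hc ha hca
    rw [h1] at h
    exact ⟨p₁, q₁, p₂, q₂, h⟩
  · left
    obtain ⟨p₁, q₁, p₂, q₂, rfl, rfl, h⟩ := exists_isNormalForm g ha hb hab
    exact ⟨p₁, q₁, p₂, q₂, h, h.eigenvalue_mul_eps hc hca hcb⟩

lemma tendsto_norm_atTop_of_infty {α : ℕ → ℂ}
    (h : Tendsto (fun k => (α k : OnePoint ℂ)) atTop (𝓝 OnePoint.infty)) :
    Tendsto (fun k => ‖α k‖) atTop atTop := by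
  have h1 : Tendsto α atTop (comap ((↑) : ℂ → OnePoint ℂ) (𝓝 OnePoint.infty)) :=
    tendsto_comap_iff.2 h
  rw [OnePoint.comap_coe_nhds_infty, coclosedCompact_eq_cocompact] at h1
  exact tendsto_norm_cocompact_atTop.comp h1

/-- A sequence in `ℂ` that converges in the Riemann sphere converges in `ℂ` or escapes to `∞`. -/
lemma tendsto_or_norm_tendsto_atTop {α : ℕ → ℂ}
    (h : ∃ l : Sphere, Tendsto (fun k => (α k : OnePoint ℂ)) atTop (𝓝 l)) :
    (∃ l : ℂ, Tendsto α atTop (𝓝 l)) ∨ Tendsto (fun k => ‖α k‖) atTop atTop := by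
  obtain ⟨l, hl⟩ := h
  induction l using OnePoint.rec with
  | infty => exact Or.inr (tendsto_norm_atTop_of_infty hl)
  | coe l => exact Or.inl ⟨l, OnePoint.isOpenEmbedding_coe.isInducing.tendsto_nhds_iff.2 hl⟩

/-- Two of the three eigenvalues cannot be large together with the third: the product `α β` would
be too large. -/
lemma false_of_four_le {α β γ : ℂ} (hrel : γ * (1 - α * β) = 2 - α - β) (hα : 4 ≤ ‖α‖)
    (hβ : 4 ≤ ‖β‖) (hγ : 4 ≤ ‖γ‖) : False := by
  have h1 : ‖2 - α - β‖ ≤ 2 + ‖α‖ + ‖β‖ := by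
    refine (norm_sub_le _ _).trans ?_
    have := norm_sub_le 2 α
    rw [RCLike.norm_ofNat] at this
    linarith
  have h2 : ‖α‖ * ‖β‖ - 1 ≤ ‖1 - α * β‖ := by
    have := norm_sub_norm_le (α * β) 1
    rwa [norm_mul, norm_one, norm_sub_rev] at this
  have h3 : 4 * ‖1 - α * β‖ ≤ ‖γ‖ * ‖1 - α * β‖ := by gcongr
  rw [← norm_mul, hrel] at h3
  nlinarith

/-- When `α` and `γ` are large and `β` is bounded, `β` is small. -/
lemma norm_le_of_rel {α β γ : ℂ} {B : ℝ} (hrel : γ * (1 - α * β) = 2 - α - β) (hα : 1 ≤ ‖α‖)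
    (hβ : ‖β‖ ≤ B) (hγ : 0 < ‖γ‖) : ‖β‖ ≤ 1 / ‖α‖ + (3 + B) / ‖γ‖ := by
  have hα0 : α ≠ 0 := norm_pos_iff.1 (by linarith)
  have hγ0 : γ ≠ 0 := norm_pos_iff.1 hγ
  have h1 : β = 1 / α - (2 - α - β) / α / γ := by
    rw [← hrel]; field_simp; ring
  have h2 : ‖(2 - α - β) / α‖ ≤ 3 + B := by
    rw [norm_div, div_le_iff₀ (by linarith)]
    have h3 : ‖2 - α - β‖ ≤ 2 + ‖α‖ + ‖β‖ := by
      refine (norm_sub_le _ _).trans ?_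
      have := norm_sub_le 2 α
      rw [RCLike.norm_ofNat] at this
      linarith
    have hB : 0 ≤ B := (norm_nonneg _).trans hβ
    nlinarith
  calc ‖β‖ = ‖1 / α - (2 - α - β) / α / γ‖ := by rw [← h1]
    _ ≤ ‖1 / α‖ + ‖(2 - α - β) / α / γ‖ := norm_sub_le _ _
    _ ≤ _ := by
      rw [norm_div, norm_one, norm_div _ γ]
      gcongr

/-- The eigenvalue at a fixed point cannot tend to `∞` together with `γ`. -/
lemma not_tendsto_norm_atTop {g : ℕ → QuadraticRationalMap} {α β γ : ℕ → ℂ}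
    (hg : ∀ᶠ k in atTop, (∃ p₁ q₁ p₂ q₂ : ℂ, IsNormalForm (g k) (α k) (β k) p₁ q₁ p₂ q₂) ∧
      γ k * (1 - α k * β k) = 2 - α k - β k)
    (hβ : ∃ l : Sphere, Tendsto (fun k => (β k : OnePoint ℂ)) atTop (𝓝 l))
    (hγ : Tendsto (fun k => ‖γ k‖) atTop atTop) {n : ℕ} (hn : 1 < n) {z : ℕ → Sphere}
    (hz : ∀ k, Function.minimalPeriod (g k) (z k) = n) {M : ℝ}
    (hM : ∀ k, ‖eigenvalue ((g k)^[n]) (z k)‖ ≤ M) : ¬ Tendsto (fun k => ‖α k‖) atTop atTop := by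
  intro hα
  rcases tendsto_or_norm_tendsto_atTop hβ with ⟨m, hm⟩ | hinf
  · obtain ⟨η, hη, H⟩ := exists_lt_norm_prod_normalDeriv hn.le M
    have hB : ∀ᶠ k in atTop, ‖β k‖ ≤ ‖m‖ + 1 :=
      (hm.norm.eventually_lt_const (lt_add_one _)).mono fun k hk => hk.le
    have hlim : Tendsto (fun k => 1 / ‖α k‖ + (3 + (‖m‖ + 1)) / ‖γ k‖) atTop (𝓝 0) := by
      simpa using ((tendsto_const_nhds (x := (1 : ℝ))).div_atTop hα).add
        ((tendsto_const_nhds (x := 3 + (‖m‖ + 1))).div_atTop hγ)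
    obtain ⟨k, ⟨⟨p₁, q₁, p₂, q₂, hk⟩, hrel⟩, hBk, hk1, hk2, hk3, hk4⟩ :=
      (hg.and (hB.and ((hlim.eventually_lt_const hη).and ((hα.eventually_ge_atTop 1).and
        ((hα.eventually_ge_atTop (1 / η)).and (hγ.eventually_gt_atTop 0)))))).exists
    obtain ⟨t, -, h1, hstep, hcyc, hprod⟩ := hk.exists_cycle hn (hz k)
    have hβk := (norm_le_of_rel hrel hk2 hBk hk4).trans hk1.le
    have hαk : 1 ≤ η * ‖α k‖ := by rwa [div_le_iff₀' hη] at hk3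
    have := H _ _ t hαk hβk h1 hstep hcyc
    rw [← hprod] at this
    exact absurd (hM k) (not_le.2 this)
  · obtain ⟨k, ⟨-, hrel⟩, h1, h2, h3⟩ := (hg.and ((hα.eventually_ge_atTop 4).and
      ((hinf.eventually_ge_atTop 4).and (hγ.eventually_ge_atTop 4)))).exists
    exact false_of_four_le hrel h1 h2 h3

/-- If `α → l`, the distance of `α` to `l` is controlled by `α ^ q - 1` for those `q` for which
this becomes small. -/
lemma exists_norm_sub_le_of_pow {α : ℕ → ℂ} {e : ℕ → ℝ} {l : ℂ} (hα : Tendsto α atTop (𝓝 l))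
    (he : Tendsto e atTop (𝓝 0)) (C : ℝ) {q : ℕ} (hq : 1 ≤ q) :
    ∃ C' : ℝ, ∀ᶠ k in atTop, ‖α k ^ q - 1‖ ≤ C * e k → l ^ q = 1 ∧ ‖α k - l‖ ≤ C' * e k := by
  by_cases hl : l ^ q = 1
  · have hl0 : l ≠ 0 := by
      rintro rfl
      rw [zero_pow (by omega)] at hl
      exact zero_ne_one hl
    -- `l` is a simple zero of `x ^ q - 1`
    have hd : (q : ℂ) * l ^ (q - 1) ≠ 0 :=
      mul_ne_zero (by exact_mod_cast (by omega : q ≠ 0)) (pow_ne_zero _ hl0)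
    have hO := ((hasDerivAt_pow q l).isTheta_sub hd).2.comp_tendsto
      (hα.prodMk tendsto_const_pure)
    obtain ⟨c, hc0, hc⟩ := hO.exists_pos
    refine ⟨c * C, ?_⟩
    filter_upwards [hc.bound] with k hk hsmall
    refine ⟨hl, ?_⟩
    simp only [Function.comp_apply, hl] at hk
    calc ‖α k - l‖ ≤ c * ‖α k ^ q - 1‖ := hk
      _ ≤ c * (C * e k) := by gcongr
      _ = _ := by ring
  · refine ⟨0, ?_⟩
    have h1 : Tendsto (fun k => ‖α k ^ q - 1‖) atTop (𝓝 ‖l ^ q - 1‖) :=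
      ((hα.pow q).sub_const 1).norm
    have h2 : Tendsto (fun k => C * e k) atTop (𝓝 0) := by simpa using he.const_mul C
    have hpos : 0 < ‖l ^ q - 1‖ := norm_pos_iff.2 (sub_ne_zero.2 hl)
    filter_upwards [h2.eventually_lt h1 hpos] with k hk hsmall
    exact absurd hsmall (not_le.2 hk)

end RationalDynamics

open RationalDynamics in
theorem mainTheorem3
    (g : ℕ → RationalDynamics.QuadraticRationalMap)
    (a b c : ℕ → RationalDynamics.Sphere)
    (hfix : ∀ k, RationalDynamics.IsFixedPointList (g k) {a k, b k, c k})
    (α β γ : ℕ → ℂ)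
    (hα : ∀ k, α k = RationalDynamics.eigenvalue (g k) (a k))
    (hβ : ∀ k, β k = RationalDynamics.eigenvalue (g k) (b k))
    (hγ : ∀ k, γ k = RationalDynamics.eigenvalue (g k) (c k))
    (hα_lim : ∃ l : RationalDynamics.Sphere,
      Tendsto (fun k => (α k : OnePoint ℂ)) atTop (𝓝 l))
    (hβ_lim : ∃ l : RationalDynamics.Sphere,
      Tendsto (fun k => (β k : OnePoint ℂ)) atTop (𝓝 l))
    (hγ_lim : Tendsto (fun k => (γ k : OnePoint ℂ)) atTop (𝓝 OnePoint.infty))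
    (n : ℕ) (hn : 1 < n)
    (z : ℕ → RationalDynamics.Sphere)
    (hz : ∀ k, Function.minimalPeriod (g k) (z k) = n)
    (hbdd : ∃ M : ℝ, ∀ k, ‖RationalDynamics.eigenvalue ((g k)^[n]) (z k)‖ ≤ M) :
    ∃ (ω : ℂ) (q : ℕ), 1 ≤ q ∧ q ≤ n ∧ ω ^ q = 1 ∧ ω ≠ 1 ∧
      (fun k => α k - ω) =O[atTop] (fun k => √‖1 - α k * β k‖) ∧
      (fun k => β k - (starRingEnd ℂ) ω) =O[atTop] (fun k => √‖1 - α k * β k‖) ∧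
      (fun k => 1 - α k * β k) =O[atTop] (fun k => 1 / γ k) := by
  obtain ⟨M, hM⟩ := hbdd
  have hγn := tendsto_norm_atTop_of_infty hγ_lim
  -- all but finitely many of the maps have a normal form with parameters `α k` and `β k`
  have hg : ∀ᶠ k in atTop, (∃ p₁ q₁ p₂ q₂ : ℂ, IsNormalForm (g k) (α k) (β k) p₁ q₁ p₂ q₂) ∧
      γ k * (1 - α k * β k) = 2 - α k - β k := by
    obtain ⟨C, hC⟩ := exists_norm_sub_one_le_of_double hn.le M
    filter_upwards [hγn.eventually_gt_atTop 1, hγn.eventually_gt_atTop (C + 1)] with k hk1 hk2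
    have hk1' := hk1
    rw [hγ k] at hk1'
    have h := exists_isNormalForm_or_double (hfix k) hk1'
    rw [← hα k, ← hβ k, ← hγ k] at h
    rcases h with ⟨p₁, q₁, p₂, q₂, h1, h2⟩ | ⟨p₁, q₁, p₂, q₂, h1⟩
    · exact ⟨⟨p₁, q₁, p₂, q₂, h1⟩, h2⟩
    · obtain ⟨t, -, h2, h3, h4, h5⟩ := h1.exists_cycle hn (hz k)
      have h6 := hC (γ k) t h2 h3 h4 (by rw [← h5]; exact hM k)
      have h7 := norm_sub_norm_le (γ k) 1
      rw [norm_one] at h7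
      linarith
  -- both limits are finite
  obtain ⟨l, hl⟩ := (tendsto_or_norm_tendsto_atTop hα_lim).resolve_right
    (not_tendsto_norm_atTop hg hβ_lim hγn hn hz hM)
  obtain ⟨m, hm⟩ := (tendsto_or_norm_tendsto_atTop hβ_lim).resolve_right
    (not_tendsto_norm_atTop (α := β) (β := α) (hg.mono fun k hk => by
      obtain ⟨⟨p₁, q₁, p₂, q₂, h1⟩, h2⟩ := hk
      exact ⟨⟨q₁, p₁, q₂, p₂, h1.swap⟩, by linear_combination h2⟩) hα_lim hγn hn hz hM)
  have hεO : (fun k => 1 - α k * β k) =O[atTop] (fun k => 1 / γ k) := by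
    have hbd : (fun k => 2 - α k - β k) =O[atTop] (fun _ => (1 : ℂ)) :=
      (((tendsto_const_nhds (x := (2 : ℂ))).sub hl).sub hm).isBigO_one ℂ
    refine (hbd.mul (isBigO_refl (fun k => 1 / γ k) atTop)).congr' ?_ ?_
    · filter_upwards [hg, hγn.eventually_gt_atTop 0] with k hk hk0
      have : γ k ≠ 0 := norm_pos_iff.1 hk0
      rw [← hk.2]
      field_simp
    · simp
  have hε0 : Tendsto (fun k => 1 - α k * β k) atTop (𝓝 0) := by
    refine hεO.trans_tendsto ?_
    rw [tendsto_zero_iff_norm_tendsto_zero]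
    simp only [one_div, norm_inv]
    exact tendsto_inv_atTop_zero.comp hγn
  have hlm : l * m = 1 := by
    have h := tendsto_nhds_unique hε0 ((hl.mul hm).const_sub 1)
    linear_combination h
  have hl0 : l ≠ 0 := left_ne_zero_of_mul_eq_one hlm
  have hm0 : m ≠ 0 := right_ne_zero_of_mul_eq_one hlm
  have hlp : 0 < ‖l‖ := norm_pos_iff.2 hl0
  have hmp : 0 < ‖m‖ := norm_pos_iff.2 hm0
  -- `A` bounds `α`, `1 / α` and `1 / β` along the sequence
  obtain ⟨A, hA1, hA2, hA3, hA4⟩ : ∃ A : ℝ, 1 ≤ A ∧ ‖l‖ < A ∧ 1 < A * ‖l‖ ∧ 1 < A * ‖m‖ := by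
    refine ⟨1 + ‖l‖ + 1 / ‖l‖ + 1 / ‖m‖, ?_, ?_, ?_, ?_⟩
    · have : 0 < ‖l‖ + 1 / ‖l‖ + 1 / ‖m‖ := by positivity
      linarith
    · have : 0 < 1 / ‖l‖ + 1 / ‖m‖ := by positivity
      linarith
    · rw [← div_lt_iff₀ hlp]
      have : 0 < 1 + ‖l‖ + 1 / ‖m‖ := by positivity
      linarith
    · rw [← div_lt_iff₀ hmp]
      have : 0 < 1 + ‖l‖ + 1 / ‖l‖ := by positivity
      linarith
  have hA2' := hl.norm.eventually_lt_const hA2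
  have hA3' := (hl.norm.const_mul A).eventually_const_lt hA3
  have hA4' := (hm.norm.const_mul A).eventually_const_lt hA4
  have hε1 : ∀ᶠ k in atTop, ‖1 - α k * β k‖ < 1 :=
    hε0.norm.eventually_lt_const (by simp)
  obtain ⟨C, hC⟩ := exists_norm_pow_sub_one_le hn.le hA1 M
  have hpow : ∀ᶠ k in atTop, ∃ q, 1 ≤ q ∧ q ≤ n ∧ ‖α k ^ q - 1‖ ≤ C * √‖1 - α k * β k‖ := by
    filter_upwards [hg, hA2', hA3', hA4', hε1] with k hk h1 h2 h3 h4
    obtain ⟨⟨p₁, q₁, p₂, q₂, h5⟩, -⟩ := hk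
    obtain ⟨t, h6, h7, h8, h9, h10⟩ := h5.exists_cycle hn (hz k)
    exact hC _ _ t h1.le h2.le h3.le h4.le h6 h7 h8 h9 (by rw [← h10]; exact hM k)
  have he : Tendsto (fun k => √‖1 - α k * β k‖) atTop (𝓝 0) := by
    simpa using hε0.norm.sqrt
  have hq : ∀ q : ℕ, ∃ C' : ℝ, 1 ≤ q → ∀ᶠ k in atTop,
      ‖α k ^ q - 1‖ ≤ C * √‖1 - α k * β k‖ →
        l ^ q = 1 ∧ ‖α k - l‖ ≤ C' * √‖1 - α k * β k‖ := by
    intro q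
    by_cases h : 1 ≤ q
    · obtain ⟨C', hC'⟩ := exists_norm_sub_le_of_pow hl he C h
      exact ⟨C', fun _ => hC'⟩
    · exact ⟨0, fun h' => absurd h' h⟩
  choose C' hC' using hq
  set D : ℝ := ∑ q ∈ Finset.Icc 1 n, |C' q| with hD
  have hall : ∀ᶠ k in atTop, ∀ q ∈ Finset.Icc 1 n, ‖α k ^ q - 1‖ ≤ C * √‖1 - α k * β k‖ →
      l ^ q = 1 ∧ ‖α k - l‖ ≤ C' q * √‖1 - α k * β k‖ :=
    (Filter.eventually_all_finset _).2 fun q hq => hC' q (Finset.mem_Icc.1 hq).1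
  have hmain : ∀ᶠ k in atTop, (∃ q, 1 ≤ q ∧ q ≤ n ∧ l ^ q = 1) ∧
      ‖α k - l‖ ≤ D * √‖1 - α k * β k‖ := by
    filter_upwards [hpow, hall] with k ⟨q, h1, h2, h3⟩ hk
    have hmem := Finset.mem_Icc.2 ⟨h1, h2⟩
    obtain ⟨h4, h5⟩ := hk q hmem h3
    refine ⟨⟨q, h1, h2, h4⟩, h5.trans ?_⟩
    gcongr
    exact (le_abs_self _).trans
      (Finset.single_le_sum (f := fun q => |C' q|) (fun _ _ => abs_nonneg _) hmem)
  obtain ⟨-, ⟨q, hq1, hqn, hlq⟩, -⟩ := hmain.exists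
  have hαO : (fun k => α k - l) =O[atTop] (fun k => √‖1 - α k * β k‖) := by
    refine IsBigO.of_bound D ?_
    filter_upwards [hmain] with k hk
    rw [Real.norm_of_nonneg (Real.sqrt_nonneg _)]
    exact hk.2
  have hlnorm : ‖l‖ = 1 := Complex.norm_eq_one_of_pow_eq_one hlq (by omega)
  refine ⟨l, q, hq1, hqn, hlq, ?_, hαO, ?_, hεO⟩
  · rintro rfl
    have hhalf : ∀ᶠ k in atTop, ‖α k - 1‖ < 1 / 2 :=
      (hl.sub_const 1).norm.eventually_lt_const (by simp)
    obtain ⟨k, ⟨⟨p₁, q₁, p₂, q₂, h1⟩, h2⟩, h3, h4, h5⟩ := (hg.and (hmain.and (hhalf.and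
      (hγn.eventually_gt_atTop (2 * (D ^ 2 + 1)))))).exists
    exact absurd (norm_le_of_norm_sub_one_le h1.eps_ne_zero h2 h3.2 h4.le) (not_le.2 h5)
  · have hconj : (starRingEnd ℂ) l = m := by
      rw [← Complex.inv_eq_conj hlnorm]
      exact inv_eq_of_mul_eq_one_right hlm
    rw [hconj]
    have hεe : (fun k => 1 - α k * β k) =O[atTop] (fun k => √‖1 - α k * β k‖) := by
      refine IsBigO.of_bound 1 ?_
      filter_upwards [hε1] with k hk
      rw [Real.norm_of_nonneg (Real.sqrt_nonneg _), one_mul]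
      exact Real.le_sqrt_of_sq_le (by nlinarith [norm_nonneg (1 - α k * β k)])
    -- `β - m = -m (β (α - l) + (1 - α β))`, with `β` bounded
    have hβ1 : β =O[atTop] (fun _ => (1 : ℝ)) := hm.isBigO_one ℝ
    have h1 := (hβ1.mul hαO).add (by simpa using hεe)
    refine (h1.const_mul_left (-m)).congr (fun k => ?_) (fun k => by simp)
    linear_combination (β k) * hlm
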